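/- Let $f:\mathbb R^2\to\mathbb R$ be a real polynomial in two variables and $\rho(x,y)=x^2+y^2$. Assume that $f$ is primitive, i.e. $f\neq P\circ\rho$ for every polynomial $P$ in one variable. Let $M(f)=\{\mathrm{Jac}(f,\rho)=0\}$ be the Milnor set, let $g$ be the product of the distinct irreducible factors of $\mathrm{Jac}(f,\rho)$, and let $\mu(M(f))$ be the set of points of $M(f)$ at which $y g_x-x g_y=0$. The Milnor radius at infinity $R_0$ is the infimum of all $r>0$ such that $\mu(M(f))$ is contained in the open disk of radius $r$ centred at the origin. The Milnor arcs at infinity of $f$ are the connected components of $M(f)\setminus\overline D_{R_0}$, where $\overline D_r$ is the closed disk of radius $r$ centred at the origin. A Milnor arc $\delta$ is the consecutive of a Milnor arc $\gamma$ (and $\gamma$ is the antecedent of $\delta$) if, on every large enough circle centred at the origin, moving counterclockwise from the point of $\gamma$ one arrives at the point of $\delta$ without meeting any other point of $M(f)$. For $\lambda\in\mathbb R$, $f$ increases to $\lambda$ along a Milnor arc $\gamma$ if, for a parametrization $\gamma(s)$, $s\in\,]R_0,\infty[$, with $\lim_{s\to\infty}\|\gamma(s)\|=\infty$, the function $f(\gamma(s))$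 is strictly increasing for all large $s$ and $\lim_{s\to\infty}f(\gamma(s))=\lambda$. An increasing $\mu$-cluster of $f$ associated to $\lambda$ is a nonempty sequence of consecutive Milnor arcs $\gamma_k,\dots,\gamma_{k+l}$ along each of which $f$ increases to $\lambda$, whereas $f$ increases to $\lambda$ neither along the antecedent of $\gamma_k$ nor along the consecutive of $\gamma_{k+l}$. For $R>0$ let $f_R$ be the restriction of $f$ to $\mathbb R^2\setminus\overline D_R$. **Theorem.** Let $f$ be primitive and $\lambda\in\mathbb R$. There are only finitely many increasing $\mu$-clusters $\mathcal C_1,\dots,\mathcal C_n$ of $f$ associated to $\lambda$. For every large enough $R>R_0$ there exists $\eta>0$ such that, for every $t\in\,]\lambda-\eta,\lambda[$: 1. for every $i$ there is exactly one connected component $\alpha_t(\mathcal C_i)$ of $f_R^{-1}(t)$ that intersects all the Milnor arcs in $\mathcal C_i$; 2. the map $\alpha_t$ from $\{\mathcal C_1,\dots,\mathcal C_n\}$ to the set of connected components of $f_R^{-1}(t)$ is injective. -/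

import Mathlib

open Filter Topology MvPolynomial

noncomputable section

namespace MilnorCluster

/-- The plane `ℝ²` with its Euclidean norm. -/
abbrev Plane : Type := EuclideanSpace ℝ (Fin 2)

/-- Polynomials in two real variables. -/
abbrev Poly : Type := MvPolynomial (Fin 2) ℝ

/-- The polynomial function `ℝ² → ℝ` of a polynomial. -/
def value (f : Poly) (p : Plane) : ℝ := eval (fun i => p i) f

/-- `ρ = x² + y²`, the square of the distance to the origin, as a polynomial. -/
def rho : Poly := X 0 ^ 2 + X 1 ^ 2

/-- `f` is primitive (relative to `ρ`): it is not of the form `P ∘ ρ`. -/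
def IsPrimitive (f : Poly) : Prop :=
  ∀ P : Polynomial ℝ, f ≠ Polynomial.aeval rho P

/-- The Jacobian determinant of the map `(g, ρ) : ℝ² → ℝ²`. -/
def jac (g : Poly) : Poly :=
  pderiv 0 g * pderiv 1 rho - pderiv 1 g * pderiv 0 rho

/-- The Milnor set `M(f) = {Jac(f, ρ) = 0}`. -/
def milnorSet (f : Poly) : Set Plane := {p | value (jac f) p = 0}

/-- `g` is a product of the pairwise non-associated irreducible factors of `h`, each taken once
(for `h ≠ 0` this determines `g` up to a nonzero constant). -/
def IsReducedForm (g h : Poly) : Prop :=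
  Squarefree g ∧ ∀ q : Poly, Irreducible q → (q ∣ g ↔ q ∣ h)

/-- `μ(M(f))`: the points of `M(f)` at which `ρ` is not transverse to the reduced curve
`M(f)_red = {g = 0}`, that is, `g = 0` and `y g_x - x g_y = 0`. -/
def nonTransverseSet (f : Poly) : Set Plane :=
  {p | p ∈ milnorSet f ∧
    ∃ g : Poly, IsReducedForm g (jac f) ∧
      p 1 * value (pderiv 0 g) p - p 0 * value (pderiv 1 g) p = 0}

/-- The Milnor radius at infinity `R₀`: the infimum of the radii `r > 0` such that `μ(M(f))` lies
in the open disk of radius `r` centred at the origin. -/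
def milnorRadius (f : Poly) : ℝ :=
  sInf {r : ℝ | 0 < r ∧ nonTransverseSet f ⊆ Metric.ball (0 : Plane) r}

/-- The connected components of a subset of the plane. -/
def components (S : Set Plane) : Set (Set Plane) :=
  {K | ∃ p ∈ S, K = connectedComponentIn S p}

/-- The Milnor arcs at infinity: the connected components of `M(f)` outside the closed disk of
radius `R₀`. -/
def milnorArcs (f : Poly) : Set (Set Plane) :=
  components (milnorSet f \ Metric.closedBall (0 : Plane) (milnorRadius f))

/-- Counterclockwise rotation of the plane about the origin by the angle `θ`. -/
def rot (θ : ℝ) (p : Plane) : Plane :=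
  !₂[Real.cos θ * p 0 - Real.sin θ * p 1, Real.sin θ * p 0 + Real.cos θ * p 1]

/-- `δ` is the consecutive of `γ` (and `γ` the antecedent of `δ`): on every large enough circle
centred at the origin, moving counterclockwise from the point of `γ` one arrives at the point of
`δ` without meeting any other point of the Milnor set. -/
def IsConsecutive (f : Poly) (γ δ : Set Plane) : Prop :=
  ∀ᶠ r : ℝ in atTop, ∃ p ∈ γ, ‖p‖ = r ∧
    ∃ θ : ℝ, 0 < θ ∧ rot θ p ∈ δ ∧ ∀ φ ∈ Set.Ioo 0 θ, rot φ p ∉ milnorSet f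

/-- `c : ]R₀, ∞[ → ℝ²` is a parametrization of the Milnor arc `γ` that tends to infinity. -/
def IsParametrization (f : Poly) (γ : Set Plane) (c : ℝ → Plane) : Prop :=
  ContinuousOn c (Set.Ioi (milnorRadius f)) ∧
  Set.InjOn c (Set.Ioi (milnorRadius f)) ∧
  c '' Set.Ioi (milnorRadius f) = γ ∧
  Tendsto (fun s => ‖c s‖) atTop atTop

/-- `f` increases to `a` along the Milnor arc `γ`: along a parametrization tending to infinity,
`f` is strictly increasing near infinity with limit `a`. -/
def IncreasesTo (f : Poly) (γ : Set Plane) (a : ℝ) : Prop :=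
  ∃ c : ℝ → Plane, IsParametrization f γ c ∧
    (∃ s₀ > milnorRadius f, StrictMonoOn (fun s => value f (c s)) (Set.Ioi s₀)) ∧
    Tendsto (fun s => value f (c s)) atTop (𝓝 a)

/-- Increasing `μ`-clusters at `a`: nonempty sequences of consecutive Milnor arcs along all of
which `f` increases to `a`, while it does so neither along the antecedent of the first arc nor
along the consecutive of the last arc. -/
structure IsIncreasingCluster (f : Poly) (a : ℝ) (C : List (Set Plane)) : Prop where
  ne_nil : C ≠ []
  arcs : ∀ γ ∈ C, γ ∈ milnorArcs f
  chain : C.IsChain (IsConsecutive f)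
  increases : ∀ γ ∈ C, IncreasesTo f γ a
  antecedent : ∀ ν ∈ milnorArcs f, IsConsecutive f ν (C.head ne_nil) → ¬ IncreasesTo f ν a
  consecutive : ∀ ν ∈ milnorArcs f, IsConsecutive f (C.getLast ne_nil) ν → ¬ IncreasesTo f ν a

/-- The fibre `f_R⁻¹(t)`, where `f_R` is the restriction of `f` to the complement of the closed
disk of radius `R` centred at the origin. -/
def fibreOutside (f : Poly) (R t : ℝ) : Set Plane :=
  {p | p ∉ Metric.closedBall (0 : Plane) R ∧ value f p = t}

/-- The set `F` intersects every Milnor arc of the sequence `C`. -/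
def MeetsAllArcs (F : Set Plane) (C : List (Set Plane)) : Prop :=
  ∀ γ ∈ C, (F ∩ γ).Nonempty

end MilnorCluster

end

/-!
In polar coordinates `(r, θ)` the Jacobian `Jac(f, ρ)` is a nonzero multiple of `∂f/∂θ`, so `M(f)`
is the set where `f`, restricted to a circle about the origin, is critical; between two
neighbouring points of `M(f)` on a circle, `f` is strictly monotone in `θ`.

Structure of `M(f)` at infinity. As `f` is primitive, `Jac(f, ρ) ≠ 0` (`jac_ne_zero`). The
common zeros of an irreducible real polynomial `q` and a polynomial it does not divide form a
bounded set (`exists_bound_common_zeros`, Gauss's lemma), and the zero set of `q` is bounded if `q`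
divides `∂q/∂θ`, because `q` then vanishes on whole circles (`exists_bound_zeros_of_dvd_angDeriv`). Hence
the non-transverse set is bounded (`nonTransverseSet_bounded`). Outside the closed disk of radius
`R₀` the distance to the origin is therefore a proper local homeomorphism from `M(f)` to the
half-line `]R₀, ∞[`, that is, a finite covering (`isCoveringMap_outerNorm`). The half-line being
simply connected, `M(f)` splits there into finitely many graphs `θ = s r` of continuous functions,
called branches; they never cross, the Milnor arcs are their images (`mem_milnorArcs_iff`), and
the consecutive of an arc is the arc of the next branch (`IsConsecutive.exists_isNext`).

Behaviour of `f` along an arc. The derivative of `f` along a branch with respect to `r` is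
`∂f/∂r`. By the same algebra applied to `Jac(f, ρ)` and `x ∂f/∂x + y ∂f/∂y` (`exists_splitting`),
far from the origin it has no zero or vanishes identically. So `f` is eventually strictly
increasing or nonincreasing on each arc (`IsBranch.strictMonoOn_or_antitoneOn`), and for large `R`
and `t < a` close to `a` the fibre over `t` outside the disk of radius `R` meets each arc along
which `f` increases to `a` exactly once and meets no other arc (`exists_fibre_structure`).

Conclusion. Between two consecutive arcs of a cluster, the part of the fibre at radii between
those of its two end points is a graph over an interval of radii and joins them
(`IsNext.connectedComponentIn_eq`), so one component meets all the arcs of the cluster; it is the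
only one, since the fibre has a single point on each of these arcs. A component meeting a cluster
cannot leave the sectors spanned by the cluster, as these are bounded by arcs that the fibre
does not meet (`arc_mem_of_mem_connectedComponentIn`), whence injectivity. A cluster is determined
by its first arc (`IsIncreasingCluster.eq_of_head_eq`), whence finiteness.
-/

noncomputable section

namespace MilnorCluster

/-! ### Common zeros of coprime polynomials -/

/-- If `q` is irreducible over a unique factorization domain `A` and does not divide `e`, then
`q` and `e` are coprime over the fraction field by Gauss's lemma; clearing denominators in a Bézout
identity yields a nonzero constant in the ideal `(q, e)`. -/
lemma exists_eliminant {A : Type*} [CommRing A] [IsDomain A] [UniqueFactorizationMonoid A]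
    {q e : Polynomial A} (hq : Irreducible q) (hqe : ¬ q ∣ e) :
    ∃ d : A, d ≠ 0 ∧ ∃ a b : Polynomial A, a * q + b * e = Polynomial.C d := by
  classical
  by_cases hdeg : q.natDegree = 0
  · obtain ⟨d, hd⟩ := Polynomial.natDegree_eq_zero.1 hdeg
    refine ⟨d, ?_, 1, 0, by simp [hd]⟩
    rintro rfl
    exact hq.ne_zero (by simp [← hd])
  · have hprim : q.IsPrimitive := hq.isPrimitive hdeg
    let K := FractionRing A
    have hirr : Irreducible (q.map (algebraMap A K)) :=
      (hprim.irreducible_iff_irreducible_map_fraction_map (K := K)).1 hq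
    have hndvd : ¬ q.map (algebraMap A K) ∣ e.map (algebraMap A K) :=
      fun h => hqe (hprim.dvd_of_fraction_map_dvd_fraction_map h)
    obtain ⟨a, b, hab⟩ := (EuclideanDomain.dvd_or_coprime _ _ hirr).resolve_left hndvd
    obtain ⟨u, hu, hua⟩ := IsLocalization.integerNormalization_spec (nonZeroDivisors A) a
    obtain ⟨v, hv, hvb⟩ := IsLocalization.integerNormalization_spec (nonZeroDivisors A) b
    refine ⟨u * v, mul_ne_zero (nonZeroDivisors.ne_zero hu) (nonZeroDivisors.ne_zero hv),
      Polynomial.C v * IsLocalization.integerNormalization (nonZeroDivisors A) a,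
      Polynomial.C u * IsLocalization.integerNormalization (nonZeroDivisors A) b, ?_⟩
    apply Polynomial.map_injective _ (IsFractionRing.injective A K)
    simp only [Polynomial.map_add, Polynomial.map_mul, Polynomial.map_C, hua, hvb, map_mul,
      Algebra.smul_def, Polynomial.algebraMap_apply]
    linear_combination (Polynomial.C (algebraMap A K u) * Polynomial.C (algebraMap A K v)) * hab

lemma value_add (p q : Poly) (x : Plane) : value (p + q) x = value p x + value q x := by
  simp [value]

lemma value_mul (p q : Poly) (x : Plane) : value (p * q) x = value p x * value q x := by
  simp [value]

lemma eq_zero_of_value_eq_zero {p : Poly} (h : ∀ x, value p x = 0) : p = 0 :=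
  MvPolynomial.funext fun x => by simpa [value] using h (WithLp.toLp 2 x)

/-- The zeros of a nonzero polynomial in one variable are bounded. -/
lemma exists_bound_roots {P : Polynomial ℝ} (hP : P ≠ 0) :
    ∃ B : ℝ, ∀ y, P.eval y = 0 → |y| ≤ B := by
  obtain ⟨B, hB⟩ := (P.roots.toFinset.finite_toSet.image (fun y : ℝ => |y|)).bddAbove
  exact ⟨B, fun y hy => hB ⟨y, by simpa [hP] using hy, rfl⟩⟩

/-- Eliminating the first variable bounds the second coordinate of the common zeros. -/
lemma exists_bound_second_coord {q e : Poly} (hq : Irreducible q) (hqe : ¬ q ∣ e) :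
    ∃ B : ℝ, ∀ x : Fin 2 → ℝ, eval x q = 0 → eval x e = 0 → |x 1| ≤ B := by
  let Φ := finSuccEquiv ℝ 1
  have hq' : Irreducible (Φ q) := (MulEquiv.irreducible_iff Φ.toMulEquiv).2 hq
  have hqe' : ¬ Φ q ∣ Φ e := fun h => hqe ((map_dvd_iff Φ).1 h)
  obtain ⟨d, hd, a, b, hab⟩ := exists_eliminant hq' hqe'
  let P : Polynomial ℝ := aeval (fun _ => Polynomial.X) d
  have hPe : ∀ y : ℝ, P.eval y = eval (fun _ => y) d := by
    intro y
    have h : (Polynomial.aeval y).comp (aeval fun _ => Polynomial.X) =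
        (aeval (fun _ => y) : MvPolynomial (Fin 1) ℝ →ₐ[ℝ] ℝ) := by
      ext i
      simp
    have hd := DFunLike.congr_fun h d
    rw [AlgHom.comp_apply, Polynomial.coe_aeval_eq_eval] at hd
    exact hd.trans (by rw [aeval_def, Algebra.algebraMap_self]; rfl)
  have hP : P ≠ 0 := by
    intro h0
    refine hd (MvPolynomial.funext fun s => ?_)
    have := hPe (s 0)
    rw [h0] at this
    have hs : (fun _ => s 0) = s := by ext i; rw [Subsingleton.elim i 0]
    rw [hs] at this
    simpa using this.symm
  obtain ⟨B, hB⟩ := exists_bound_roots hP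
  refine ⟨B, fun x hx hx' => hB _ ?_⟩
  rw [hPe]
  have hcons : x = Fin.cons (x 0) (fun _ => x 1) := by
    ext i; fin_cases i <;> rfl
  have key := congrArg (fun p => Polynomial.eval (x 0) (p.map (eval fun _ => x 1))) hab
  rw [hcons, eval_eq_eval_mv_eval'] at hx hx'
  simpa [Φ, hx, hx'] using key.symm

/-- A real polynomial vanishing together with an irreducible polynomial that does not divide it
does so only in a bounded set. -/
lemma exists_bound_common_zeros {q e : Poly} (hq : Irreducible q) (hqe : ¬ q ∣ e) :
    ∃ B : ℝ, ∀ x : Plane, value q x = 0 → value e x = 0 → ‖x‖ ≤ B := by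
  obtain ⟨B₁, h₁⟩ := exists_bound_second_coord hq hqe
  let σ := renameEquiv ℝ (Equiv.swap (0 : Fin 2) 1)
  have hq' : Irreducible (σ q) := (MulEquiv.irreducible_iff σ.toMulEquiv).2 hq
  have hqe' : ¬ σ q ∣ σ e := fun h => hqe ((map_dvd_iff σ).1 h)
  obtain ⟨B₀, h₀⟩ := exists_bound_second_coord hq' hqe'
  refine ⟨|B₀| + |B₁|, fun x hx hx' => ?_⟩
  have hx1 := h₁ (fun i => x i) hx hx'
  have hx0 : |x 0| ≤ B₀ := by
    have hsw : ((fun i => x i) ∘ Equiv.swap (0 : Fin 2) 1) ∘ Equiv.swap (0 : Fin 2) 1 =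
        fun i => x i := by ext i; simp
    refine h₀ ((fun i => x i) ∘ Equiv.swap (0 : Fin 2) 1) ?_ ?_
    · simpa only [σ, renameEquiv_apply, eval_rename, hsw, value] using hx
    · simpa only [σ, renameEquiv_apply, eval_rename, hsw, value] using hx'
  rw [EuclideanSpace.norm_eq]
  apply Real.sqrt_le_iff.2
  refine ⟨by positivity, ?_⟩
  simp only [Fin.sum_univ_two, Real.norm_eq_abs]
  have := le_abs_self B₀
  have := le_abs_self B₁
  nlinarith [abs_nonneg (x 0), abs_nonneg (x 1), abs_nonneg B₀, abs_nonneg B₁]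

/-! ### Polar coordinates and derivations -/

/-- The point of the plane with polar coordinates `r`, `θ`. -/
def pol (r θ : ℝ) : Plane := !₂[r * Real.cos θ, r * Real.sin θ]

@[simp] lemma pol_zero_coord (r θ : ℝ) : pol r θ 0 = r * Real.cos θ := rfl

@[simp] lemma pol_one_coord (r θ : ℝ) : pol r θ 1 = r * Real.sin θ := rfl

lemma norm_sq_eq (x : Plane) : ‖x‖ ^ 2 = x 0 ^ 2 + x 1 ^ 2 := by
  simp [EuclideanSpace.norm_sq_eq]

lemma norm_pol {r : ℝ} (hr : 0 ≤ r) (θ : ℝ) : ‖pol r θ‖ = r := by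
  rw [← sq_eq_sq₀ (norm_nonneg _) hr, norm_sq_eq]
  simp only [pol_zero_coord, pol_one_coord]
  linear_combination r ^ 2 * Real.cos_sq_add_sin_sq θ

lemma exists_eq_pol (x : Plane) : ∃ θ, x = pol ‖x‖ θ := by
  let z : ℂ := ⟨x 0, x 1⟩
  have hz : ‖z‖ = ‖x‖ := by
    rw [← sq_eq_sq₀ (norm_nonneg _) (norm_nonneg _), norm_sq_eq, Complex.sq_norm,
      Complex.normSq_apply]
    simp only [z]
    ring
  refine ⟨z.arg, ?_⟩
  have h0 := Complex.norm_mul_cos_arg z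
  have h1 := Complex.norm_mul_sin_arg z
  rw [hz] at h0 h1
  ext i
  fin_cases i
  · exact h0.symm
  · exact h1.symm

lemma pol_add_int_mul_two_pi (r θ : ℝ) (k : ℤ) : pol r (θ + k * (2 * Real.pi)) = pol r θ := by
  simp only [pol, Real.cos_add_int_mul_two_pi, Real.sin_add_int_mul_two_pi]

lemma rot_pol (r θ φ : ℝ) : rot φ (pol r θ) = pol r (θ + φ) := by
  ext i
  fin_cases i
  · simp [rot, pol, Real.cos_add]; ring
  · simp [rot, pol, Real.sin_add]; ring

lemma pol_eq_pol_iff {r θ r' θ' : ℝ} (hr : 0 < r) (hr' : 0 < r') :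
    pol r θ = pol r' θ' ↔ r = r' ∧ ∃ k : ℤ, θ' = θ + k * (2 * Real.pi) := by
  constructor
  · intro h
    have hrr : r = r' := by rw [← norm_pol hr.le θ, h, norm_pol hr'.le]
    subst hrr
    refine ⟨rfl, ?_⟩
    have h0 := congrArg (fun x : Plane => x 0) h
    have h1 := congrArg (fun x : Plane => x 1) h
    simp only [pol_zero_coord, pol_one_coord] at h0 h1
    have hc := mul_left_cancel₀ hr.ne' h0
    have hs := mul_left_cancel₀ hr.ne' h1
    have := Real.Angle.cos_sin_inj hc hs
    obtain ⟨k, hk⟩ := Real.Angle.angle_eq_iff_two_pi_dvd_sub.1 this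
    exact ⟨-k, by push_cast; linarith⟩
  · rintro ⟨rfl, k, rfl⟩
    rw [pol_add_int_mul_two_pi]

/-- The angular derivative `x ∂/∂y - y ∂/∂x`, that is, `∂/∂θ` in polar coordinates. -/
def angDeriv (p : Poly) : Poly := X 0 * pderiv 1 p - X 1 * pderiv 0 p

/-- The Euler derivative `x ∂/∂x + y ∂/∂y`, that is, `r ∂/∂r` in polar coordinates. -/
def radDeriv (p : Poly) : Poly := X 0 * pderiv 0 p + X 1 * pderiv 1 p

lemma value_angDeriv (p : Poly) (x : Plane) :
    value (angDeriv p) x = x 0 * value (pderiv 1 p) x - x 1 * value (pderiv 0 p) x := by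
  simp [value, angDeriv]

lemma value_radDeriv (p : Poly) (x : Plane) :
    value (radDeriv p) x = x 0 * value (pderiv 0 p) x + x 1 * value (pderiv 1 p) x := by
  simp [value, radDeriv]

lemma angDeriv_mul (p q : Poly) : angDeriv (p * q) = angDeriv p * q + p * angDeriv q := by
  simp only [angDeriv, Derivation.leibniz, smul_eq_mul]
  ring

lemma jac_eq (f : Poly) : jac f = C (-2) * angDeriv f := by
  have h0 : pderiv 0 rho = 2 * X 0 := by
    simp [rho, pderiv_X, Derivation.leibniz_pow]
  have h1 : pderiv 1 rho = 2 * X 1 := by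
    simp [rho, pderiv_X, Derivation.leibniz_pow]
  have hC : (C (-2) : Poly) = -2 := by
    rw [map_neg, map_ofNat]
  rw [jac, angDeriv, h0, h1, hC]
  ring

lemma mem_milnorSet_iff {f : Poly} {x : Plane} :
    x ∈ milnorSet f ↔ value (angDeriv f) x = 0 := by
  rw [milnorSet, Set.mem_ofPred_eq, jac_eq, value_mul]
  simp [value]

/-- The chain rule for a polynomial along a curve. -/
lemma hasDerivAt_value_comp (p : Poly) {c : ℝ → Plane} {t u v : ℝ}
    (h0 : HasDerivAt (fun s => c s 0) u t) (h1 : HasDerivAt (fun s => c s 1) v t) :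
    HasDerivAt (fun s => value p (c s))
      (value (pderiv 0 p) (c t) * u + value (pderiv 1 p) (c t) * v) t := by
  induction p using MvPolynomial.induction_on with
  | C a => simpa [value] using hasDerivAt_const t a
  | add p q hp hq =>
    have h : (fun s => value (p + q) (c s)) = fun s => value p (c s) + value q (c s) := by
      simp only [value_add]
    rw [h]
    refine (hp.add hq).congr_deriv ?_
    simp only [map_add, value_add]
    ring
  | mul_X p i hp =>
    have h : (fun s => value (p * X i) (c s)) = fun s => value p (c s) * c s i :=
      funext fun s => by simp [value]
    rw [h]
    fin_cases i
    · refine (hp.mul h0).congr_deriv ?_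
      simp [value, pderiv_X]
      ring
    · refine (hp.mul h1).congr_deriv ?_
      simp [value, pderiv_X]
      ring

lemma hasStrictFDerivAt_value (p : Poly) (x : Plane) :
    HasStrictFDerivAt (value p)
      (value (pderiv 0 p) x • (EuclideanSpace.proj 0 : Plane →L[ℝ] ℝ) +
        value (pderiv 1 p) x • (EuclideanSpace.proj 1 : Plane →L[ℝ] ℝ)) x := by
  induction p using MvPolynomial.induction_on with
  | C a =>
    have h : value (C a) = fun _ => a := funext fun y => by simp [value]
    rw [h]
    simpa [value] using hasStrictFDerivAt_const (𝕜 := ℝ) a x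
  | add p q hp hq =>
    have h : value (p + q) = fun y => value p y + value q y := funext (value_add p q)
    rw [h]
    refine (hp.add hq).congr_fderiv ?_
    simp only [map_add, value_add, add_smul]
    abel
  | mul_X p i hp =>
    have hi : HasStrictFDerivAt (fun y : Plane => y i) (EuclideanSpace.proj i : Plane →L[ℝ] ℝ) x :=
      (EuclideanSpace.proj i : Plane →L[ℝ] ℝ).hasStrictFDerivAt
    have h : value (p * X i) = fun y => value p y * y i := funext fun y => by simp [value]
    rw [h]
    refine (hp.mul hi).congr_fderiv ?_
    ext y
    fin_cases i
    · simp [value, pderiv_X]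
      ring
    · simp [value, pderiv_X]
      ring

lemma continuous_value (p : Poly) : Continuous (value p) :=
  continuous_iff_continuousAt.2 fun x => (hasStrictFDerivAt_value p x).continuousAt

lemma continuous_pol : Continuous fun z : ℝ × ℝ => pol z.1 z.2 := by
  refine (PiLp.continuous_toLp 2 _).comp (continuous_pi fun i => ?_)
  fin_cases i
  · show Continuous fun z : ℝ × ℝ => z.1 * Real.cos z.2
    fun_prop
  · show Continuous fun z : ℝ × ℝ => z.1 * Real.sin z.2
    fun_prop

lemma hasDerivAt_value_pol (p : Poly) (r θ : ℝ) :
    HasDerivAt (fun s => value p (pol r s)) (value (angDeriv p) (pol r θ)) θ := by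
  have h0 : HasDerivAt (fun s => pol r s 0) (r * -Real.sin θ) θ :=
    (Real.hasDerivAt_cos θ).const_mul r
  have h1 : HasDerivAt (fun s => pol r s 1) (r * Real.cos θ) θ :=
    (Real.hasDerivAt_sin θ).const_mul r
  convert hasDerivAt_value_comp p h0 h1 using 1
  rw [value_angDeriv]
  simp only [pol_zero_coord, pol_one_coord]
  ring

/-- The univariate polynomial `p(r, 0)`. -/
def axisPoly (p : Poly) : Polynomial ℝ := aeval ![Polynomial.X, 0] p

lemma eval_axisPoly (p : Poly) (r : ℝ) : (axisPoly p).eval r = value p (pol r 0) := by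
  have h : (Polynomial.aeval r).comp (aeval ![Polynomial.X, 0]) =
      (aeval (fun i => pol r 0 i) : Poly →ₐ[ℝ] ℝ) := by
    ext i
    fin_cases i <;> simp
  have hp := DFunLike.congr_fun h p
  rw [AlgHom.comp_apply, Polynomial.coe_aeval_eq_eval] at hp
  exact hp.trans (by rw [aeval_def, Algebra.algebraMap_self]; rfl)

/-! ### Boundedness of the non-transverse set -/

/-- A solution of a linear ordinary differential equation that vanishes somewhere is zero. -/
lemma eq_zero_of_hasDerivAt_mul {u c : ℝ → ℝ} (hc : Continuous c)
    (hu : ∀ t, HasDerivAt u (c t * u t) t) {t₀ : ℝ} (h₀ : u t₀ = 0) (t : ℝ) : u t = 0 := by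
  have hF : ∀ t, HasDerivAt (fun t => ∫ s in t₀..t, c s) (c t) t :=
    fun t => intervalIntegral.integral_hasDerivAt_right (hc.intervalIntegrable _ _)
      (hc.stronglyMeasurableAtFilter _ _) hc.continuousAt
  have hw : ∀ t, HasDerivAt (fun t => u t * Real.exp (-∫ s in t₀..t, c s)) 0 t := by
    intro t
    exact ((hu t).mul (hF t).neg.exp).congr_deriv (by ring)
  have hconst := is_const_of_deriv_eq_zero (fun t => (hw t).differentiableAt)
    (fun t => (hw t).deriv) t t₀
  simpa [h₀, Real.exp_ne_zero] using hconst

/-- If `q` divides its angular derivative, then `q` vanishes on every circle about the origin on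
which it has a zero, so the radii of these circles are roots of `q(r, 0)`. -/
lemma exists_bound_zeros_of_dvd_angDeriv {q : Poly} (hq : q ≠ 0) (hdvd : q ∣ angDeriv q) :
    ∃ B : ℝ, ∀ x, value q x = 0 → ‖x‖ ≤ B := by
  obtain ⟨c, hc⟩ := hdvd
  have key : ∀ r θ₀, value q (pol r θ₀) = 0 → ∀ θ, value q (pol r θ) = 0 := by
    intro r θ₀ h₀
    refine eq_zero_of_hasDerivAt_mul (c := fun θ => value c (pol r θ)) ?_ (fun θ => ?_) h₀
    · exact (continuous_value c).comp (continuous_pol.comp (by fun_prop : Continuous fun θ => (r, θ)))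
    · convert hasDerivAt_value_pol q r θ using 1
      rw [hc, value_mul, mul_comm]
  have hQ : axisPoly q ≠ 0 := by
    intro h
    refine hq (eq_zero_of_value_eq_zero fun x => ?_)
    obtain ⟨θ, hθ⟩ := exists_eq_pol x
    rw [hθ]
    exact key _ 0 (by rw [← eval_axisPoly, h, Polynomial.eval_zero]) θ
  obtain ⟨B, hB⟩ := exists_bound_roots hQ
  refine ⟨B, fun x hx => ?_⟩
  obtain ⟨θ, hθ⟩ := exists_eq_pol x
  rw [← abs_of_nonneg (norm_nonneg x)]
  apply hB
  rw [eval_axisPoly]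
  exact key _ θ (hθ ▸ hx) 0

/-- On the zero set of a squarefree polynomial the angular derivative vanishes only in a bounded
set. -/
lemma exists_bound_critical_zeros {g : Poly} (hg : Squarefree g) :
    ∃ B : ℝ, ∀ x, value g x = 0 → value (angDeriv g) x = 0 → ‖x‖ ≤ B := by
  induction g using WfDvdMonoid.induction_on_irreducible with
  | zero => exact absurd hg not_squarefree_zero
  | unit u hu =>
    refine ⟨0, fun x hx => ?_⟩
    have := hu.map (eval (fun i => x i))
    rw [show eval (fun i => x i) u = 0 from hx] at this
    exact absurd this not_isUnit_zero
  | mul k q hk hq ih =>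
    obtain ⟨B₁, h₁⟩ := ih (hg.of_mul_right)
    have hqk : ¬ q ∣ k := fun h => hq.not_isUnit (hg q (mul_dvd_mul_left q h))
    obtain ⟨B₂, h₂⟩ := exists_bound_common_zeros hq hqk
    obtain ⟨B₃, h₃⟩ : ∃ B : ℝ, ∀ x, value q x = 0 → value (angDeriv q) x = 0 → ‖x‖ ≤ B := by
      by_cases h : q ∣ angDeriv q
      · obtain ⟨B, hB⟩ := exists_bound_zeros_of_dvd_angDeriv hq.ne_zero h
        exact ⟨B, fun x hx _ => hB x hx⟩
      · exact exists_bound_common_zeros hq h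
    refine ⟨max B₁ (max B₂ B₃), fun x hx hx' => ?_⟩
    rw [value_mul] at hx
    rw [angDeriv_mul, value_add, value_mul, value_mul] at hx'
    by_cases hqx : value q x = 0
    · rw [hqx, zero_mul, add_zero, mul_eq_zero] at hx'
      rcases hx' with h | h
      · exact (h₃ x hqx h).trans ((le_max_right _ _).trans (le_max_right _ _))
      · exact (h₂ x hqx h).trans ((le_max_left _ _).trans (le_max_right _ _))
    · have hkx := (mul_eq_zero.1 hx).resolve_left hqx
      rw [hkx, mul_zero, zero_add, mul_eq_zero] at hx'
      exact (h₁ x hkx (hx'.resolve_left hqx)).trans (le_max_left _ _)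

lemma IsReducedForm.dvd {g h k : Poly} (hg : IsReducedForm g h) (hk : IsReducedForm k h) :
    g ∣ k := by
  have main : ∀ g : Poly, Squarefree g → (∀ q, Irreducible q → q ∣ g → q ∣ k) → g ∣ k := by
    intro g hg
    induction g using WfDvdMonoid.induction_on_irreducible with
    | zero => exact absurd hg not_squarefree_zero
    | unit u hu => exact fun _ => hu.dvd
    | mul l q hl hq ih =>
      intro hdvd
      have hql : ¬ q ∣ l := fun h => hq.not_isUnit (hg q (mul_dvd_mul_left q h))
      exact ((hq.isRelPrime_iff_not_dvd).2 hql).mul_dvd (hdvd q hq (dvd_mul_right _ _))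
        (ih hg.of_mul_right fun q' hq' h => hdvd q' hq' (h.mul_left _))
  exact main g hg.1 fun q hq h => (hk.2 q hq).2 ((hg.2 q hq).1 h)

lemma exists_isReducedForm {h : Poly} (hh : h ≠ 0) : ∃ g, IsReducedForm g h := by
  classical
  let _ : StrongNormalizationMonoid Poly := UniqueFactorizationMonoid.strongNormalizationMonoid
  exact ⟨UniqueFactorizationMonoid.radical h, UniqueFactorizationMonoid.squarefree_radical,
    fun q hq => UniqueFactorizationMonoid.dvd_radical_iff_of_irreducible hq hh⟩

/-- A polynomial and its reduced form have the same zeros. -/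
lemma IsReducedForm.value_eq_zero_iff {g h : Poly} (hg : IsReducedForm g h) (hh : h ≠ 0)
    (x : Plane) : value g x = 0 ↔ value h x = 0 := by
  have main : ∀ k l : Poly, k ≠ 0 → (∀ q, Irreducible q → q ∣ k → q ∣ l) → value k x = 0 →
      value l x = 0 := by
    intro k l hk
    induction k using WfDvdMonoid.induction_on_irreducible with
    | zero => exact absurd rfl hk
    | unit u hu =>
      intro _ hx
      have := hu.map (eval (fun i => x i))
      rw [show eval (fun i => x i) u = 0 from hx] at this
      exact absurd this not_isUnit_zero
    | mul m q hm hq ih =>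
      intro hdvd hx
      rw [value_mul, mul_eq_zero] at hx
      rcases hx with hx | hx
      · obtain ⟨c, rfl⟩ := hdvd q hq (dvd_mul_right _ _)
        rw [value_mul, hx, zero_mul]
      · exact ih hm (fun q' hq' h => hdvd q' hq' (h.mul_left _)) hx
  exact ⟨main g h hg.1.ne_zero fun q hq => (hg.2 q hq).1, main h g hh fun q hq => (hg.2 q hq).2⟩

/-- A polynomial with zero angular derivative is a polynomial in `ρ`. -/
lemma jac_ne_zero {f : Poly} (hf : IsPrimitive f) : jac f ≠ 0 := by
  intro hJ
  have hD : ∀ x, value (angDeriv f) x = 0 := fun x => by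
    rw [← mem_milnorSet_iff, milnorSet, Set.mem_ofPred_eq, hJ]
    simp [value]
  have hconst : ∀ r θ, value f (pol r θ) = (axisPoly f).eval r := by
    intro r θ
    rw [eval_axisPoly]
    exact is_const_of_deriv_eq_zero (fun t => (hasDerivAt_value_pol f r t).differentiableAt)
      (fun t => by rw [(hasDerivAt_value_pol f r t).deriv, hD]) θ 0
  set Q := axisPoly f with hQdef
  -- Rotation by `π` maps `(r, 0)` to `(-r, 0)`, so `f(r, 0)` is even in `r`.
  have heven : Q.comp (Polynomial.C (-1) * Polynomial.X) = Q := by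
    refine Polynomial.funext fun r => ?_
    rw [Polynomial.eval_comp, ← hconst r Real.pi, hQdef, eval_axisPoly]
    congr 1
    ext i
    fin_cases i <;> simp
  have hodd : ∀ n, ¬ 2 ∣ n → Q.coeff n = 0 := by
    intro n hn
    have h := congrArg (fun P => Polynomial.coeff P n) heven
    simp only [Polynomial.comp_C_mul_X_coeff] at h
    rw [(Nat.odd_iff.2 (by omega)).neg_one_pow] at h
    linarith
  refine hf (Polynomial.contract 2 Q) ?_
  have hexp : Polynomial.expand ℝ 2 (Polynomial.contract 2 Q) = Q := by
    ext n
    rw [Polynomial.coeff_expand two_pos]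
    split_ifs with h
    · rw [Polynomial.coeff_contract two_ne_zero, Nat.div_mul_cancel h]
    · exact (hodd n h).symm
  refine MvPolynomial.funext fun x => ?_
  have h1 : eval x (Polynomial.aeval rho (Polynomial.contract 2 Q)) =
      (Polynomial.contract 2 Q).eval (eval x rho) := by
    have := Polynomial.aeval_algHom_apply (aeval x : Poly →ₐ[ℝ] ℝ) rho (Polynomial.contract 2 Q)
    rw [Polynomial.coe_aeval_eq_eval] at this
    exact this.symm
  let y : Plane := WithLp.toLp 2 x
  have h2 : eval x rho = ‖y‖ ^ 2 := by
    rw [norm_sq_eq]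
    simp [rho, y]
  obtain ⟨θ, hθ⟩ := exists_eq_pol y
  have h3 : value f y = Q.eval ‖y‖ := by rw [← hconst _ θ, ← hθ]
  rw [h1, h2, ← Polynomial.expand_eval, hexp, ← h3]
  rfl

lemma nonTransverseSet_bounded {f : Poly} (hf : IsPrimitive f) :
    ∃ r : ℝ, 0 < r ∧ nonTransverseSet f ⊆ Metric.ball 0 r := by
  obtain ⟨g₀, hg₀⟩ := exists_isReducedForm (jac_ne_zero hf)
  obtain ⟨B, hB⟩ := exists_bound_critical_zeros hg₀.1
  refine ⟨|B| + 1, by positivity, ?_⟩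
  rintro x ⟨hx, g, hg, hgx⟩
  obtain ⟨u, rfl⟩ := hg.dvd hg₀
  have h0 : value g x = 0 := (hg.value_eq_zero_iff (jac_ne_zero hf) x).2 hx
  have h1 : value (angDeriv g) x = 0 := by rw [value_angDeriv]; linarith
  have := hB x (by rw [value_mul, h0, zero_mul])
    (by rw [angDeriv_mul, value_add, value_mul, value_mul, h0, h1]; ring)
  rw [mem_ball_zero_iff]
  linarith [le_abs_self B]

lemma milnorRadius_nonneg (f : Poly) : 0 ≤ milnorRadius f :=
  Real.sInf_nonneg fun _ h => h.1.le

/-- Outside the closed disk of radius `R₀` the reduced curve is transverse to the circles. -/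
lemma value_angDeriv_ne_zero {f g : Poly} (hf : IsPrimitive f) (hg : IsReducedForm g (jac f))
    {x : Plane} (hx : x ∈ milnorSet f) (hR : milnorRadius f < ‖x‖) :
    value (angDeriv g) x ≠ 0 := by
  intro h
  obtain ⟨r, ⟨-, hr⟩, hrx⟩ := exists_lt_of_csInf_lt (nonTransverseSet_bounded hf) hR
  have : x ∈ nonTransverseSet f := ⟨hx, g, hg, by rw [value_angDeriv] at h; linarith⟩
  exact hrx.not_gt (mem_ball_zero_iff.1 (hr this))

/-- The zero set of `J` splits into a part on which `e` vanishes and a part on which `e` vanishes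
only in a bounded set, according to whether an irreducible factor of `J` divides `e` or not. -/
lemma exists_splitting {J : Poly} (hJ : J ≠ 0) (e : Poly) :
    ∃ (g₁ g₂ : Poly) (B : ℝ), (∀ x, value J x = 0 → value g₁ x = 0 ∨ value g₂ x = 0) ∧
      (∀ x, value g₁ x = 0 → value e x = 0) ∧
      ∀ x, value g₂ x = 0 → value e x = 0 → ‖x‖ ≤ B := by
  induction J using WfDvdMonoid.induction_on_irreducible with
  | zero => exact absurd rfl hJ
  | unit u hu =>
    refine ⟨1, 1, 0, fun x hx => ?_, fun x hx => ?_, fun x hx => ?_⟩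
    · have := hu.map (eval (fun i => x i))
      rw [show eval (fun i => x i) u = 0 from hx] at this
      exact absurd this not_isUnit_zero
    · simp [value] at hx
    · simp [value] at hx
  | mul k q hk hq ih =>
    obtain ⟨g₁, g₂, B, h, h₁, h₂⟩ := ih hk
    by_cases hqe : q ∣ e
    · refine ⟨q * g₁, g₂, B, fun x hx => ?_, fun x hx => ?_, h₂⟩
      · rw [value_mul, mul_eq_zero] at hx ⊢
        rcases hx with hx | hx
        · exact .inl (.inl hx)
        · exact (h x hx).imp_left .inr
      · rw [value_mul, mul_eq_zero] at hx
        rcases hx with hx | hx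
        · obtain ⟨c, rfl⟩ := hqe
          rw [value_mul, hx, zero_mul]
        · exact h₁ x hx
    · obtain ⟨B', hB'⟩ := exists_bound_common_zeros hq hqe
      refine ⟨g₁, q * g₂, max B B', fun x hx => ?_, h₁, fun x hx hx' => ?_⟩
      · rw [value_mul, mul_eq_zero] at hx ⊢
        rcases hx with hx | hx
        · exact .inr (.inl hx)
        · exact (h x hx).imp_right .inr
      · rw [value_mul, mul_eq_zero] at hx
        rcases hx with hx | hx
        · exact (hB' x hx hx').trans (le_max_right _ _)
        · exact (h₂ x hx hx').trans (le_max_left _ _)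

/-! ### The Milnor set at infinity as a covering of the radial half-line -/

/-- The Milnor set outside the closed disk whose radius is the Milnor radius. -/
def outerSet (f : Poly) : Set Plane := milnorSet f \ Metric.closedBall 0 (milnorRadius f)

lemma mem_outerSet {f : Poly} {x : Plane} :
    x ∈ outerSet f ↔ x ∈ milnorSet f ∧ milnorRadius f < ‖x‖ := by
  simp [outerSet]

lemma value_rho (x : Plane) : value rho x = ‖x‖ ^ 2 := by
  rw [norm_sq_eq]
  simp [value, rho]

/-- Where `g` has nonzero angular derivative, `(ρ, g)` is a local diffeomorphism of the plane. -/
lemma exists_hasStrictFDerivAt_equiv {g : Poly} {x : Plane} (hx : value (angDeriv g) x ≠ 0) :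
    ∃ e : Plane ≃L[ℝ] ℝ × ℝ,
      HasStrictFDerivAt (fun y => (value rho y, value g y)) (e : Plane →L[ℝ] ℝ × ℝ) x := by
  have h := (hasStrictFDerivAt_value rho x).prodMk (hasStrictFDerivAt_value g x)
  set L := ContinuousLinearMap.prod
    (value (pderiv 0 rho) x • (EuclideanSpace.proj 0 : Plane →L[ℝ] ℝ) +
        value (pderiv 1 rho) x • (EuclideanSpace.proj 1 : Plane →L[ℝ] ℝ))
    (value (pderiv 0 g) x • (EuclideanSpace.proj 0 : Plane →L[ℝ] ℝ) +
        value (pderiv 1 g) x • (EuclideanSpace.proj 1 : Plane →L[ℝ] ℝ)) with hL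
  have h0 : value (pderiv 0 rho) x = 2 * x 0 := by
    simp [value, rho, pderiv_X, Derivation.leibniz_pow]
  have h1 : value (pderiv 1 rho) x = 2 * x 1 := by
    simp [value, rho, pderiv_X, Derivation.leibniz_pow]
  have hinj : Function.Injective L.toLinearMap := by
    rw [injective_iff_map_eq_zero]
    intro v hv
    have e1 : 2 * x 0 * v 0 + 2 * x 1 * v 1 = 0 := by
      simpa [hL, h0, h1] using congrArg Prod.fst hv
    have e2 : value (pderiv 0 g) x * v 0 + value (pderiv 1 g) x * v 1 = 0 := by
      simpa [hL] using congrArg Prod.snd hv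
    rw [value_angDeriv] at hx
    have v0 : (x 0 * value (pderiv 1 g) x - x 1 * value (pderiv 0 g) x) * v 0 = 0 := by
      linear_combination value (pderiv 1 g) x / 2 * e1 - x 1 * e2
    have v1 : (x 0 * value (pderiv 1 g) x - x 1 * value (pderiv 0 g) x) * v 1 = 0 := by
      linear_combination -value (pderiv 0 g) x / 2 * e1 + x 0 * e2
    ext i
    fin_cases i
    · exact (mul_eq_zero.1 v0).resolve_left hx
    · exact (mul_eq_zero.1 v1).resolve_left hx
  refine ⟨(L.toLinearMap.linearEquivOfInjective hinj (by simp)).toContinuousLinearEquiv, ?_⟩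
  exact h

/-- The distance to the origin, as a map from the outer Milnor set to the half-line. -/
def outerNorm (f : Poly) (x : outerSet f) : Set.Ioi (milnorRadius f) :=
  ⟨‖(x : Plane)‖, (mem_outerSet.1 x.2).2⟩

lemma continuous_outerNorm (f : Poly) : Continuous (outerNorm f) :=
  (continuous_norm.comp continuous_subtype_val).subtype_mk _

lemma isOpenMap_outerNorm {f : Poly} (hf : IsPrimitive f) : IsOpenMap (outerNorm f) := by
  obtain ⟨g, hg⟩ := exists_isReducedForm (jac_ne_zero hf)
  rw [isOpenMap_iff_nhds_le]
  intro x N hN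
  obtain ⟨hxM, hxR⟩ := mem_outerSet.1 x.2
  obtain ⟨e, he⟩ := exists_hasStrictFDerivAt_equiv (value_angDeriv_ne_zero hf hg hxM hxR)
  rw [Filter.mem_map, nhds_subtype_eq_comap] at hN
  obtain ⟨N', hN', hsub⟩ := hN
  have himg := he.map_nhds_eq_of_equiv ▸ Filter.image_mem_map hN'
  have hgx : value g (x : Plane) = 0 := (hg.value_eq_zero_iff (jac_ne_zero hf) _).2 hxM
  rw [hgx, value_rho] at himg
  have hcont : Continuous fun r : Set.Ioi (milnorRadius f) => ((r : ℝ) ^ 2, (0 : ℝ)) := by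
    fun_prop
  filter_upwards [hcont.continuousAt (x := outerNorm f x) himg] with r hr
  obtain ⟨y, hyN, hy⟩ := hr
  have hy1 : ‖y‖ = r := by
    have := congrArg Prod.fst hy
    simp only [value_rho] at this
    exact (sq_eq_sq₀ (norm_nonneg _) ((milnorRadius_nonneg f).trans r.2.le)).1 this
  have hy2 : value g y = 0 := congrArg Prod.snd hy
  have hyo : y ∈ outerSet f :=
    mem_outerSet.2 ⟨(hg.value_eq_zero_iff (jac_ne_zero hf) y).1 hy2, hy1 ▸ r.2⟩
  have := hsub (show (⟨y, hyo⟩ : outerSet f) ∈ Subtype.val ⁻¹' N' from hyN)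
  rwa [Set.mem_preimage, show outerNorm f ⟨y, hyo⟩ = r from Subtype.ext hy1] at this

lemma isLocalHomeomorph_outerNorm {f : Poly} (hf : IsPrimitive f) :
    IsLocalHomeomorph (outerNorm f) := by
  obtain ⟨g, hg⟩ := exists_isReducedForm (jac_ne_zero hf)
  rw [isLocalHomeomorph_iff_isOpenEmbedding_restrict]
  intro x
  obtain ⟨hxM, hxR⟩ := mem_outerSet.1 x.2
  obtain ⟨e, he⟩ := exists_hasStrictFDerivAt_equiv (value_angDeriv_ne_zero hf hg hxM hxR)
  let φ := he.toOpenPartialHomeomorph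
  have hU : IsOpen (Subtype.val ⁻¹' φ.source : Set (outerSet f)) :=
    φ.open_source.preimage continuous_subtype_val
  refine ⟨Subtype.val ⁻¹' φ.source, hU.mem_nhds he.mem_toOpenPartialHomeomorph_source, ?_⟩
  refine .of_continuous_injective_isOpenMap
    ((continuous_outerNorm f).comp continuous_subtype_val) ?_
    ((isOpenMap_outerNorm hf).comp hU.isOpenMap_subtype_val)
  intro y z hyz
  have hyz' : ‖(y.1 : Plane)‖ = ‖(z.1 : Plane)‖ := congrArg Subtype.val hyz
  have h0 : ∀ w : outerSet f, value g (w : Plane) = 0 := fun w =>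
    (hg.value_eq_zero_iff (jac_ne_zero hf) _).2 (mem_outerSet.1 w.2).1
  refine Subtype.ext (Subtype.ext (φ.injOn y.2 z.2 ?_))
  show (value rho (y : Plane), value g (y : Plane)) = (value rho (z : Plane), value g (z : Plane))
  rw [value_rho, value_rho, hyz', h0, h0]

/-- The distance to the origin is a proper local homeomorphism, hence a finite covering. -/
lemma isCoveringMap_outerNorm {f : Poly} (hf : IsPrimitive f) : IsCoveringMap (outerNorm f) := by
  have : LocallyCompactSpace (Set.Ioi (milnorRadius f)) := isOpen_Ioi.locallyCompactSpace
  have hproper : IsProperMap (outerNorm f) := by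
    refine isProperMap_iff_isCompact_preimage.2 ⟨continuous_outerNorm f, fun K hK => ?_⟩
    rw [Subtype.isCompact_iff]
    have hK' := Subtype.isCompact_iff.1 hK
    have himg : (Subtype.val '' (outerNorm f ⁻¹' K) : Set Plane) =
        milnorSet f ∩ norm ⁻¹' (Subtype.val '' K) := by
      ext x
      constructor
      · rintro ⟨y, hy, rfl⟩
        exact ⟨(mem_outerSet.1 y.2).1, outerNorm f y, hy, rfl⟩
      · rintro ⟨hxM, r, hr, hrx⟩
        exact ⟨⟨x, mem_outerSet.2 ⟨hxM, hrx ▸ r.2⟩⟩,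
          by rwa [Set.mem_preimage, show outerNorm f ⟨x, _⟩ = r from Subtype.ext hrx.symm], rfl⟩
    rw [himg]
    refine Metric.isCompact_of_isClosed_isBounded ?_ ?_
    · exact (isClosed_singleton.preimage (continuous_value (jac f))).inter
        (hK'.isClosed.preimage continuous_norm)
    · obtain ⟨B, hB⟩ := hK'.isBounded.exists_norm_le
      refine isBounded_iff_forall_norm_le.2 ⟨B, fun x hx => ?_⟩
      simpa using hB _ hx.2
  have hloc := isLocalHomeomorph_outerNorm hf
  rw [isCoveringMap_iff_isCoveringMapOn_univ]
  refine hproper.isClosedMap.isCoveringMapOn_of_isLocalHomeomorphOn (fun r _ => ?_)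
    (hloc.isLocalHomeomorphOn)
  refine (hproper.isCompact_preimage isCompact_singleton).finite
    (.of_openPartialHomeomorph (outerNorm f) subset_rfl fun x _ => ?_)
  obtain ⟨φ, hx, hφ⟩ := hloc x
  exact ⟨φ, hx, hφ.symm⟩

/-! ### Branches of the Milnor set -/

/-- A branch of the Milnor set: a continuous choice `θ = s r`, for `r > R₀`, of a polar angle of a
point of `M(f)` on the circle of radius `r`. Values at `r ≤ R₀` are irrelevant. -/
def IsBranch (f : Poly) (s : ℝ → ℝ) : Prop :=
  ContinuousOn s (Set.Ioi (milnorRadius f)) ∧ ∀ r > milnorRadius f, pol r (s r) ∈ milnorSet f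

/-- The curve `{(r, s r) : r > R₀}` in polar coordinates. -/
def arc (f : Poly) (s : ℝ → ℝ) : Set Plane :=
  (fun r => pol r (s r)) '' Set.Ioi (milnorRadius f)

lemma pos_of_milnorRadius_lt {f : Poly} {r : ℝ} (hr : milnorRadius f < r) : 0 < r :=
  (milnorRadius_nonneg f).trans_lt hr

lemma IsBranch.continuousOn_pol {f : Poly} {s : ℝ → ℝ} (hs : IsBranch f s) :
    ContinuousOn (fun r => pol r (s r)) (Set.Ioi (milnorRadius f)) :=
  continuous_pol.comp_continuousOn (continuousOn_id.prodMk hs.1)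

lemma IsBranch.mem_outerSet {f : Poly} {s : ℝ → ℝ} (hs : IsBranch f s) {r : ℝ}
    (hr : milnorRadius f < r) : pol r (s r) ∈ outerSet f :=
  MilnorCluster.mem_outerSet.2 ⟨hs.2 r hr, by rwa [norm_pol (pos_of_milnorRadius_lt hr).le]⟩

/-- The section of `outerNorm` defined by a branch. -/
def IsBranch.lift {f : Poly} {s : ℝ → ℝ} (hs : IsBranch f s)
    (r : Set.Ioi (milnorRadius f)) : outerSet f :=
  ⟨pol r (s r), hs.mem_outerSet r.2⟩

lemma IsBranch.continuous_lift {f : Poly} {s : ℝ → ℝ} (hs : IsBranch f s) :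
    Continuous hs.lift :=
  (continuousOn_iff_continuous_domRestrict.1 hs.continuousOn_pol).subtype_mk _

lemma IsBranch.outerNorm_lift {f : Poly} {s : ℝ → ℝ} (hs : IsBranch f s)
    (r : Set.Ioi (milnorRadius f)) : outerNorm f (hs.lift r) = r :=
  Subtype.ext (norm_pol (pos_of_milnorRadius_lt r.2).le _)

lemma IsBranch.add_int {f : Poly} {s : ℝ → ℝ} (hs : IsBranch f s) (k : ℤ) :
    IsBranch f fun r => s r + k * (2 * Real.pi) :=
  ⟨hs.1.add continuousOn_const, fun r hr => by
    rw [pol_add_int_mul_two_pi]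
    exact hs.2 r hr⟩

lemma mem_arc_iff {f : Poly} {s : ℝ → ℝ} {x : Plane} :
    x ∈ arc f s ↔ milnorRadius f < ‖x‖ ∧ x = pol ‖x‖ (s ‖x‖) := by
  constructor
  · rintro ⟨r, hr, rfl⟩
    simp only [norm_pol (pos_of_milnorRadius_lt hr).le]
    exact ⟨hr, trivial⟩
  · rintro ⟨hx, h⟩
    exact ⟨‖x‖, hx, h.symm⟩

/-- Every point of the outer Milnor set lies on a branch, with any prescribed polar angle. -/
lemma exists_isBranch {f : Poly} (hf : IsPrimitive f) {r₀ θ₀ : ℝ} (hr₀ : milnorRadius f < r₀)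
    (hM : pol r₀ θ₀ ∈ milnorSet f) : ∃ s, IsBranch f s ∧ s r₀ = θ₀ := by
  have : ContractibleSpace (Set.Ioi (milnorRadius f)) :=
    (convex_Ioi _).contractibleSpace ⟨r₀, hr₀⟩
  have : LocallyPathConnectedSpace (Set.Ioi (milnorRadius f)) :=
    isOpen_Ioi.locallyPathConnectedSpace
  have hr₀' := pos_of_milnorRadius_lt hr₀
  let x₀ : outerSet f := ⟨pol r₀ θ₀, mem_outerSet.2 ⟨hM, by rwa [norm_pol hr₀'.le]⟩⟩
  obtain ⟨σ, ⟨hσ₀, hσ⟩, -⟩ := (isCoveringMap_outerNorm hf).existsUnique_continuousMap_lifts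
    (ContinuousMap.id _) ⟨r₀, hr₀⟩ x₀ (Subtype.ext (norm_pol hr₀'.le _))
  have hnorm : ∀ r, ‖(σ r : Plane)‖ = r := fun r => congrArg Subtype.val (congrFun hσ r)
  -- A section of the covering is given; its polar angle is lifted through `exp : ℂ → ℂ \ {0}`.
  let z : Set.Ioi (milnorRadius f) → ℂ := fun r => ⟨(σ r : Plane) 0, (σ r : Plane) 1⟩
  have hzc : Continuous z := by
    have : z = fun r => ((σ r : Plane) 0 : ℂ) + ((σ r : Plane) 1 : ℂ) * Complex.I :=
      funext fun r => Complex.mk_eq_add_mul_I _ _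
    rw [this]
    fun_prop
  have hz : ∀ r, ‖z r‖ = r := fun r => by
    rw [← hnorm r, ← sq_eq_sq₀ (norm_nonneg _) (norm_nonneg _), norm_sq_eq, Complex.sq_norm,
      Complex.normSq_apply]
    simp only [z]
    ring
  have hz0 : ∀ r, z r ≠ 0 := fun r h => by
    have := hz r
    rw [h, norm_zero] at this
    exact (pos_of_milnorRadius_lt r.2).ne this
  obtain ⟨L, ⟨hL₀, hL⟩, -⟩ := Complex.isCoveringMap_exp.existsUnique_continuousMap_lifts
    ⟨fun r => (⟨z r, hz0 r⟩ : {z : ℂ // z ≠ 0}), hzc.subtype_mk _⟩ ⟨r₀, hr₀⟩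
    (⟨Real.log r₀, θ₀⟩ : ℂ) (by
      apply Subtype.ext
      apply Complex.ext
      · rw [Complex.exp_re]
        simp [z, hσ₀, x₀, Real.exp_log hr₀']
      · rw [Complex.exp_im]
        simp [z, hσ₀, x₀, Real.exp_log hr₀'])
  have hexp : ∀ r, Complex.exp (L r) = z r := fun r => congrArg Subtype.val (congrFun hL r)
  have hre : ∀ r, Real.exp (L r).re = r := fun r => by rw [← Complex.norm_exp, hexp, hz]
  have hpol : ∀ r : Set.Ioi (milnorRadius f), pol r (L r).im = σ r := fun r => by
    ext i
    fin_cases i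
    · have := congrArg Complex.re (hexp r)
      rw [Complex.exp_re, hre] at this
      exact this
    · have := congrArg Complex.im (hexp r)
      rw [Complex.exp_im, hre] at this
      exact this
  classical
  let s : ℝ → ℝ := fun r => if h : milnorRadius f < r then (L ⟨r, h⟩).im else 0
  have hs : ∀ r (h : milnorRadius f < r), s r = (L ⟨r, h⟩).im := fun r h => dif_pos h
  refine ⟨s, ⟨?_, fun r hr => ?_⟩, ?_⟩
  · rw [continuousOn_iff_continuous_domRestrict]
    have : (Set.Ioi (milnorRadius f)).domRestrict s = fun r => (L r).im :=
      funext fun r => hs r r.2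
    rw [this]
    fun_prop
  · rw [hs r hr, hpol ⟨r, hr⟩]
    exact (mem_outerSet.1 (σ _).2).1
  · rw [hs r₀ hr₀, hL₀]

/-- Branches defining the same point at one radius define the same point at every radius. -/
lemma IsBranch.pol_eq {f : Poly} (hf : IsPrimitive f) {s s' : ℝ → ℝ} (hs : IsBranch f s)
    (hs' : IsBranch f s') {r₀ : ℝ} (hr₀ : milnorRadius f < r₀)
    (h : pol r₀ (s r₀) = pol r₀ (s' r₀)) {r : ℝ} (hr : milnorRadius f < r) :
    pol r (s r) = pol r (s' r) := by
  have : PreconnectedSpace (Set.Ioi (milnorRadius f)) :=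
    isPreconnected_iff_preconnectedSpace.1 isPreconnected_Ioi
  have := (isCoveringMap_outerNorm hf).eq_of_comp_eq hs.continuous_lift hs'.continuous_lift
    (funext fun r => by simp [IsBranch.outerNorm_lift]) ⟨r₀, hr₀⟩ (Subtype.ext h)
  exact congrArg Subtype.val (congrFun this ⟨r, hr⟩)

/-- Two branches that agree at one radius agree everywhere. -/
lemma IsBranch.eq_of_eq {f : Poly} (hf : IsPrimitive f) {s s' : ℝ → ℝ} (hs : IsBranch f s)
    (hs' : IsBranch f s') {r₀ : ℝ} (hr₀ : milnorRadius f < r₀) (h : s r₀ = s' r₀) {r : ℝ}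
    (hr : milnorRadius f < r) : s r = s' r := by
  have : PreconnectedSpace (Set.Ioi (milnorRadius f)) :=
    isPreconnected_iff_preconnectedSpace.1 isPreconnected_Ioi
  have key := Circle.isCoveringMap_exp.eq_of_comp_eq
    (continuousOn_iff_continuous_domRestrict.1 hs.1)
    (continuousOn_iff_continuous_domRestrict.1 hs'.1) (funext fun u => ?_) ⟨r₀, hr₀⟩ h
  · exact congrFun key ⟨r, hr⟩
  · have hu := pos_of_milnorRadius_lt u.2
    obtain ⟨-, k, hk⟩ := (pol_eq_pol_iff hu hu).1 (hs.pol_eq hf hs' hr₀ (by rw [h]) u.2)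
    refine (Circle.exp_eq_exp).2 ⟨-k, ?_⟩
    simp only [Set.domRestrict_apply, hk]
    push_cast
    ring

lemma IsBranch.connectedComponentIn_eq {f : Poly} (hf : IsPrimitive f) {s : ℝ → ℝ}
    (hs : IsBranch f s) {x : Plane} (hx : x ∈ arc f s) :
    connectedComponentIn (outerSet f) x = arc f s := by
  obtain ⟨r₀, hr₀, rfl⟩ := hx
  have hx₀ := hs.mem_outerSet hr₀
  apply Set.Subset.antisymm
  · rw [connectedComponentIn_eq_image hx₀]
    rintro _ ⟨y, hy, rfl⟩
    -- The section defined by `s`, composed with `outerNorm`, and the identity are lifts of the same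
    -- map that agree at one point, hence on its connected component.
    have hcov := isCoveringMap_outerNorm hf
    have := hcov.isSeparatedMap.eqOn_of_comp_eqOn hcov.isLocalHomeomorph.isLocallyInjective
      (isPreconnected_connectedComponent (x := (⟨_, hx₀⟩ : outerSet f)))
      (hs.continuous_lift.comp (continuous_outerNorm f)).continuousOn continuousOn_id
      (fun z _ => hs.outerNorm_lift _) mem_connectedComponent
      (Subtype.ext (by
        simp [IsBranch.lift, outerNorm, norm_pol (pos_of_milnorRadius_lt hr₀).le]))
    rw [← show hs.lift (outerNorm f y) = y from this hy]
    exact ⟨_, (outerNorm f y).2, rfl⟩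
  · refine IsPreconnected.subset_connectedComponentIn
      (isPreconnected_Ioi.image _ hs.continuousOn_pol) ⟨r₀, hr₀, rfl⟩ ?_
    rintro _ ⟨r, hr, rfl⟩
    exact hs.mem_outerSet hr

/-- The Milnor arcs are the arcs of the branches. -/
lemma mem_milnorArcs_iff {f : Poly} (hf : IsPrimitive f) {γ : Set Plane} :
    γ ∈ milnorArcs f ↔ ∃ s, IsBranch f s ∧ γ = arc f s := by
  constructor
  · rintro ⟨x, hx, rfl⟩
    obtain ⟨hxM, hxR⟩ := mem_outerSet.1 hx
    obtain ⟨θ, hθ⟩ := exists_eq_pol x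
    obtain ⟨s, hs, hsx⟩ := exists_isBranch hf hxR (hθ ▸ hxM)
    exact ⟨s, hs, hs.connectedComponentIn_eq hf (mem_arc_iff.2 ⟨hxR, by rwa [hsx]⟩)⟩
  · rintro ⟨s, hs, rfl⟩
    have hr : milnorRadius f < milnorRadius f + 1 := by linarith
    exact ⟨_, hs.mem_outerSet hr, (hs.connectedComponentIn_eq hf ⟨_, hr, rfl⟩).symm⟩

/-- Two branches whose arcs meet define the same arc. -/
lemma arc_eq_of_mem {f : Poly} (hf : IsPrimitive f) {s s' : ℝ → ℝ} (hs : IsBranch f s)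
    (hs' : IsBranch f s') {x : Plane} (hx : x ∈ arc f s) (hx' : x ∈ arc f s') :
    arc f s = arc f s' := by
  rw [← hs.connectedComponentIn_eq hf hx, hs'.connectedComponentIn_eq hf hx']

/-! ### The cyclic order of the branches -/

lemma eventually_pol_notMem_milnorSet {f : Poly} (hf : IsPrimitive f) {r : ℝ}
    (hr : milnorRadius f < r) (θ : ℝ) : ∀ᶠ φ in 𝓝[≠] θ, pol r φ ∉ milnorSet f := by
  obtain ⟨g, hg⟩ := exists_isReducedForm (jac_ne_zero hf)
  have hiff : ∀ φ, pol r φ ∈ milnorSet f ↔ value g (pol r φ) = 0 := fun φ =>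
    (hg.value_eq_zero_iff (jac_ne_zero hf) _).symm
  have hd := hasDerivAt_value_pol g r θ
  simp only [hiff]
  by_cases h : value g (pol r θ) = 0
  · refine hd.eventually_ne (value_angDeriv_ne_zero hf hg ((hiff θ).2 h) ?_)
    rwa [norm_pol (pos_of_milnorRadius_lt hr).le]
  · exact (hd.continuousAt.eventually_ne h).filter_mono nhdsWithin_le_nhds

/-- A circle of radius greater than `R₀` meets the Milnor set in finitely many points. -/
lemma finite_zeros {f : Poly} (hf : IsPrimitive f) {r : ℝ} (hr : milnorRadius f < r) (a b : ℝ) :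
    {θ | θ ∈ Set.Icc a b ∧ pol r θ ∈ milnorSet f}.Finite := by
  by_contra hinf
  obtain ⟨θ, -, hacc⟩ := Set.Infinite.exists_accPt_of_subset_isCompact hinf
    (isCompact_Icc (a := a) (b := b)) fun θ hθ => hθ.1
  rw [accPt_iff_frequently_nhdsNE] at hacc
  exact hacc ((eventually_pol_notMem_milnorSet hf hr θ).mono fun φ hφ h => hφ h.2)

/-- Branches do not cross. -/
lemma IsBranch.lt_of_lt {f : Poly} (hf : IsPrimitive f) {s s' : ℝ → ℝ} (hs : IsBranch f s)
    (hs' : IsBranch f s') {r₀ : ℝ} (hr₀ : milnorRadius f < r₀) (h : s r₀ < s' r₀) {r : ℝ}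
    (hr : milnorRadius f < r) : s r < s' r := by
  by_contra! hle
  obtain ⟨u, hu, hsu⟩ := isPreconnected_Ioi.intermediate_value₂ (Set.mem_Ioi.2 hr₀)
    (Set.mem_Ioi.2 hr) hs.1 hs'.1 h.le hle
  exact h.ne (hs.eq_of_eq hf hs' hu hsu hr₀)

/-- `s'` is the branch that follows `s` counterclockwise: no point of the Milnor set lies strictly
between them. -/
structure IsNext (f : Poly) (s s' : ℝ → ℝ) : Prop where
  left : IsBranch f s
  right : IsBranch f s'
  lt : ∀ {r}, milnorRadius f < r → s r < s' r
  notMem : ∀ {r}, milnorRadius f < r → ∀ {θ}, s r < θ → θ < s' r → pol r θ ∉ milnorSet f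

/-- Since branches do not cross and pass through every point of the outer Milnor set, being
successive may be tested at one radius. -/
lemma isNext_of_radius {f : Poly} (hf : IsPrimitive f) {s s' : ℝ → ℝ} (hs : IsBranch f s)
    (hs' : IsBranch f s') {r₀ : ℝ} (hr₀ : milnorRadius f < r₀) (h : s r₀ < s' r₀)
    (hno : ∀ θ, s r₀ < θ → θ < s' r₀ → pol r₀ θ ∉ milnorSet f) : IsNext f s s' where
  left := hs
  right := hs'
  lt := hs.lt_of_lt hf hs' hr₀ h
  notMem := by
    intro r hr θ h1 h2 hM
    obtain ⟨u, hu, rfl⟩ := exists_isBranch hf hr hM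
    exact hno (u r₀) (hs.lt_of_lt hf hu hr h1 hr₀) (hu.lt_of_lt hf hs' hr h2 hr₀) (hu.2 r₀ hr₀)

lemma exists_isNext {f : Poly} (hf : IsPrimitive f) {s : ℝ → ℝ} (hs : IsBranch f s) :
    ∃ s', IsNext f s s' := by
  have hr : milnorRadius f < milnorRadius f + 1 := by linarith
  set r := milnorRadius f + 1
  have hper : pol r (s r + 2 * Real.pi) = pol r (s r) := by
    simpa using pol_add_int_mul_two_pi r (s r) 1
  obtain ⟨θ, ⟨⟨hθI, hθM⟩, hθs⟩, hmin⟩ := Set.exists_min_image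
    ({θ | θ ∈ Set.Icc (s r) (s r + 2 * Real.pi) ∧ pol r θ ∈ milnorSet f} ∩ {θ | s r < θ}) id
    ((finite_zeros hf hr _ _).inter_of_left _)
    ⟨s r + 2 * Real.pi, ⟨⟨by constructor <;> linarith [Real.pi_pos], hper ▸ hs.2 r hr⟩,
      show s r < _ by linarith [Real.pi_pos]⟩⟩
  obtain ⟨s', hs', rfl⟩ := exists_isBranch hf hr hθM
  refine ⟨s', isNext_of_radius hf hs hs' hr hθs fun φ h1 h2 hφ => ?_⟩
  exact (hmin φ ⟨⟨⟨h1.le, h2.le.trans hθI.2⟩, hφ⟩, h1⟩).not_gt h2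

/-- A polar angle on a given circle lies between two successive branches. -/
lemma exists_isNext_locate {f : Poly} (hf : IsPrimitive f) {s₀ : ℝ → ℝ} (hs₀ : IsBranch f s₀)
    {r : ℝ} (hr : milnorRadius f < r) (θ : ℝ) : ∃ s s', IsNext f s s' ∧ s r ≤ θ ∧ θ < s' r := by
  set k := ⌊(θ - s₀ r) / (2 * Real.pi)⌋
  have hk : s₀ r + k * (2 * Real.pi) ≤ θ := by
    have := Int.floor_le ((θ - s₀ r) / (2 * Real.pi))
    rw [le_div_iff₀ (by positivity)] at this
    linarith
  obtain ⟨φ, ⟨hφI, hφM⟩, hmax⟩ := Set.exists_max_image _ id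
    (finite_zeros hf hr (s₀ r + k * (2 * Real.pi)) θ)
    ⟨s₀ r + k * (2 * Real.pi), ⟨le_rfl, hk⟩, (hs₀.add_int k).2 r hr⟩
  obtain ⟨s, hs, rfl⟩ := exists_isBranch hf hr hφM
  obtain ⟨s', hss'⟩ := exists_isNext hf hs
  refine ⟨s, s', hss', hφI.2, ?_⟩
  by_contra! hle
  exact (hmax (s' r) ⟨⟨hφI.1.trans (hss'.lt hr).le, hle⟩, hss'.right.2 r hr⟩).not_gt (hss'.lt hr)

lemma exists_isPrev {f : Poly} (hf : IsPrimitive f) {s' : ℝ → ℝ} (hs' : IsBranch f s') :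
    ∃ s, IsNext f s s' := by
  have hr : milnorRadius f < milnorRadius f + 1 := by linarith
  set r := milnorRadius f + 1
  have hper : pol r (s' r - 2 * Real.pi) = pol r (s' r) := by
    simpa [sub_eq_add_neg] using pol_add_int_mul_two_pi r (s' r) (-1)
  obtain ⟨θ, ⟨⟨hθI, hθM⟩, hθs⟩, hmax⟩ := Set.exists_max_image
    ({θ | θ ∈ Set.Icc (s' r - 2 * Real.pi) (s' r) ∧ pol r θ ∈ milnorSet f} ∩ {θ | θ < s' r}) id
    ((finite_zeros hf hr _ _).inter_of_left _)
    ⟨s' r - 2 * Real.pi, ⟨⟨by constructor <;> linarith [Real.pi_pos], hper ▸ hs'.2 r hr⟩,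
      show _ < s' r by linarith [Real.pi_pos]⟩⟩
  obtain ⟨s, hs, rfl⟩ := exists_isBranch hf hr hθM
  refine ⟨s, isNext_of_radius hf hs hs' hr hθs fun φ h1 h2 hφ => ?_⟩
  exact (hmax φ ⟨⟨⟨hθI.1.trans h1.le, h2.le⟩, hφ⟩, h2⟩).not_gt h1

lemma finite_milnorArcs {f : Poly} (hf : IsPrimitive f) : (milnorArcs f).Finite := by
  have hr : milnorRadius f < milnorRadius f + 1 := by linarith
  set r := milnorRadius f + 1
  refine ((finite_zeros hf hr 0 (2 * Real.pi)).image
    fun θ => connectedComponentIn (outerSet f) (pol r θ)).subset ?_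
  intro γ hγ
  obtain ⟨s, hs, rfl⟩ := (mem_milnorArcs_iff hf).1 hγ
  set k := ⌊s r / (2 * Real.pi)⌋
  have h1 := Int.floor_le (s r / (2 * Real.pi))
  have h2 := Int.lt_floor_add_one (s r / (2 * Real.pi))
  rw [le_div_iff₀ (by positivity)] at h1
  rw [div_lt_iff₀ (by positivity)] at h2
  refine ⟨s r + (-k : ℤ) * (2 * Real.pi), ⟨⟨?_, ?_⟩, (hs.add_int (-k)).2 r hr⟩, ?_⟩
  · push_cast
    linarith
  · push_cast
    linarith
  · simp only [pol_add_int_mul_two_pi]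
    exact hs.connectedComponentIn_eq hf ⟨r, hr, rfl⟩

lemma exists_int_of_arc_eq {f : Poly} {s s' : ℝ → ℝ} (h : arc f s = arc f s') {r : ℝ}
    (hr : milnorRadius f < r) : ∃ k : ℤ, s' r = s r + k * (2 * Real.pi) := by
  have hr' := pos_of_milnorRadius_lt hr
  have hmem : pol r (s r) ∈ arc f s' := h ▸ ⟨r, hr, rfl⟩
  obtain ⟨-, hx⟩ := mem_arc_iff.1 hmem
  rw [norm_pol hr'.le] at hx
  exact ((pol_eq_pol_iff hr' hr').1 hx).2

/-- The arc that bounds clockwise the sector containing a point depends only on the point. -/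
lemma IsNext.arc_eq_of_pol_eq {f : Poly} (hf : IsPrimitive f) {s s' u u' : ℝ → ℝ}
    (hs : IsNext f s s') (hu : IsNext f u u') {r r' θ θ' : ℝ} (hr : milnorRadius f < r)
    (hr' : milnorRadius f < r') (h : pol r θ = pol r' θ') (h1 : s r ≤ θ) (h2 : θ < s' r)
    (h3 : u r' ≤ θ') (h4 : θ' < u' r') : arc f s = arc f u := by
  obtain ⟨rfl, k, rfl⟩ :=
    (pol_eq_pol_iff (pos_of_milnorRadius_lt hr) (pos_of_milnorRadius_lt hr')).1 h
  have huk : u r = s r + k * (2 * Real.pi) := by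
    rcases lt_trichotomy (u r) (s r + k * (2 * Real.pi)) with hlt | heq | hlt
    · exact absurd ((hs.left.add_int k).2 r hr) (hu.notMem hr hlt (by linarith))
    · exact heq
    · have := (hu.left.add_int (-k)).2 r hr
      push_cast at this
      exact absurd this (hs.notMem hr (by linarith) (by linarith))
  refine arc_eq_of_mem hf hs.left hu.left (x := pol r (s r)) ⟨r, hr, rfl⟩ ⟨r, hr, ?_⟩
  simp only [huk, pol_add_int_mul_two_pi]

lemma IsNext.arc_right_eq {f : Poly} (hf : IsPrimitive f) {s s' u u' : ℝ → ℝ}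
    (hs : IsNext f s s') (hu : IsNext f u u') (h : arc f s = arc f u) : arc f s' = arc f u' := by
  have hr : milnorRadius f < milnorRadius f + 1 := by linarith
  set r := milnorRadius f + 1
  obtain ⟨k, hk⟩ := exists_int_of_arc_eq h hr
  have hlts := hs.lt hr
  have hltu := hu.lt hr
  have huk : u' r = s' r + k * (2 * Real.pi) := by
    rcases lt_trichotomy (u' r) (s' r + k * (2 * Real.pi)) with hlt | heq | hlt
    · have := (hu.right.add_int (-k)).2 r hr
      push_cast at this
      exact absurd this (hs.notMem hr (by linarith) (by linarith))
    · exact heq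
    · exact absurd ((hs.right.add_int k).2 r hr) (hu.notMem hr (by linarith) hlt)
  refine arc_eq_of_mem hf hs.right hu.right (x := pol r (s' r)) ⟨r, hr, rfl⟩ ⟨r, hr, ?_⟩
  simp only [huk, pol_add_int_mul_two_pi]

lemma IsNext.arc_left_eq {f : Poly} (hf : IsPrimitive f) {s s' u u' : ℝ → ℝ}
    (hs : IsNext f s s') (hu : IsNext f u u') (h : arc f s' = arc f u') : arc f s = arc f u := by
  have hr : milnorRadius f < milnorRadius f + 1 := by linarith
  set r := milnorRadius f + 1
  obtain ⟨k, hk⟩ := exists_int_of_arc_eq h hr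
  have hlts := hs.lt hr
  have hltu := hu.lt hr
  have huk : u r = s r + k * (2 * Real.pi) := by
    rcases lt_trichotomy (u r) (s r + k * (2 * Real.pi)) with hlt | heq | hlt
    · exact absurd ((hs.left.add_int k).2 r hr) (hu.notMem hr hlt (by linarith))
    · exact heq
    · have := (hu.left.add_int (-k)).2 r hr
      push_cast at this
      exact absurd this (hs.notMem hr (by linarith) (by linarith))
  refine arc_eq_of_mem hf hs.left hu.left (x := pol r (s r)) ⟨r, hr, rfl⟩ ⟨r, hr, ?_⟩
  simp only [huk, pol_add_int_mul_two_pi]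

lemma IsNext.isConsecutive {f : Poly} {s s' : ℝ → ℝ} (h : IsNext f s s') :
    IsConsecutive f (arc f s) (arc f s') := by
  filter_upwards [eventually_gt_atTop (milnorRadius f)] with r hr
  refine ⟨pol r (s r), ⟨r, hr, rfl⟩, norm_pol (pos_of_milnorRadius_lt hr).le _, s' r - s r,
    sub_pos.2 (h.lt hr), ?_, fun φ hφ => ?_⟩
  · rw [rot_pol, add_sub_cancel]
    exact ⟨r, hr, rfl⟩
  · rw [rot_pol]
    exact h.notMem hr (by linarith [hφ.1]) (by linarith [hφ.2])

/-- Consecutive Milnor arcs are the arcs of two successive branches. -/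
lemma IsConsecutive.exists_isNext {f : Poly} (hf : IsPrimitive f) {γ δ : Set Plane}
    (hγ : γ ∈ milnorArcs f) (hδ : δ ∈ milnorArcs f) (h : IsConsecutive f γ δ) :
    ∃ s s', IsNext f s s' ∧ γ = arc f s ∧ δ = arc f s' := by
  obtain ⟨s, hs, rfl⟩ := (mem_milnorArcs_iff hf).1 hγ
  obtain ⟨u, hu, rfl⟩ := (mem_milnorArcs_iff hf).1 hδ
  obtain ⟨s', hss'⟩ := MilnorCluster.exists_isNext hf hs
  obtain ⟨r, ⟨p, hp, hpr, θ, hθ, hpδ, hno⟩, hr⟩ :=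
    (h.and (eventually_gt_atTop (milnorRadius f))).exists
  obtain ⟨-, hps⟩ := mem_arc_iff.1 hp
  rw [hpr] at hps
  rw [hps, rot_pol] at hpδ
  have hnext : s r + θ = s' r := by
    rcases lt_trichotomy (s r + θ) (s' r) with hlt | heq | hlt
    · have hM : pol r (s r + θ) ∈ milnorSet f := by
        obtain ⟨v, hv, hv'⟩ := hpδ
        exact hv' ▸ hu.2 v hv
      exact absurd hM (hss'.notMem hr (by linarith) hlt)
    · exact heq
    · refine absurd (hss'.right.2 r hr) ?_
      have := hno (s' r - s r) ⟨sub_pos.2 (hss'.lt hr), by linarith⟩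
      rwa [hps, rot_pol, add_sub_cancel] at this
  rw [hnext] at hpδ
  exact ⟨s, s', hss', rfl, arc_eq_of_mem hf hu hss'.right hpδ ⟨r, hr, rfl⟩⟩

/-! ### Monotonicity of `f` along a branch -/

/-- Along a branch only the radial derivative of `f` contributes, as the angular one vanishes. -/
lemma IsBranch.hasDerivAt_value {f : Poly} (hf : IsPrimitive f) {s : ℝ → ℝ} (hs : IsBranch f s)
    {r : ℝ} (hr : milnorRadius f < r) :
    HasDerivAt (fun t => value f (pol t (s t))) (value (radDeriv f) (pol r (s r)) / r) r := by
  obtain ⟨g, hg⟩ := exists_isReducedForm (jac_ne_zero hf)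
  have hr0 := pos_of_milnorRadius_lt hr
  have hzero : ∀ t > milnorRadius f, value g (pol t (s t)) = 0 := fun t ht =>
    (hg.value_eq_zero_iff (jac_ne_zero hf) _).2 (hs.2 t ht)
  obtain ⟨e, he⟩ := exists_hasStrictFDerivAt_equiv
    (value_angDeriv_ne_zero hf hg (hs.2 r hr) (by rwa [norm_pol hr0.le]))
  have hcont : ContinuousAt (fun t => pol t (s t)) r :=
    hs.continuousOn_pol.continuousAt (Ioi_mem_nhds hr)
  -- Near `r` the branch is the image of `(t², 0)` under the local inverse of `(ρ, g)`.
  have hinv : (fun t => HasStrictFDerivAt.localInverse _ _ _ he (t ^ 2, (0 : ℝ))) =ᶠ[𝓝 r] fun t => pol t (s t) := by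
    filter_upwards [hcont.eventually he.eventually_left_inverse, Ioi_mem_nhds hr] with t ht htr
    rw [value_rho, norm_pol (pos_of_milnorRadius_lt htr).le, hzero t htr] at ht
    exact ht
  have hsq : HasDerivAt (fun t : ℝ => (t ^ 2, (0 : ℝ))) (2 * r, (0 : ℝ)) r := by
    simpa using (hasDerivAt_pow 2 r).prodMk (hasDerivAt_const r (0 : ℝ))
  have hloc := he.to_localInverse.hasFDerivAt
  rw [value_rho, norm_pol hr0.le, hzero r hr] at hloc
  have hc := (hloc.comp_hasDerivAt r hsq).congr_of_eventuallyEq hinv.symm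
  set v : Plane := (e.symm : ℝ × ℝ →L[ℝ] Plane) (2 * r, 0)
  have hi : ∀ i, HasDerivAt (fun t => pol t (s t) i) (v i) r := fun i =>
    ((EuclideanSpace.proj i : Plane →L[ℝ] ℝ).hasFDerivAt).comp_hasDerivAt r hc
  have hnorm : HasDerivAt (fun t : ℝ => t ^ 2)
      (2 * pol r (s r) 0 * v 0 + 2 * pol r (s r) 1 * v 1) r := by
    have h := ((hi 0).pow 2).add ((hi 1).pow 2)
    refine (h.congr_deriv (by norm_num)).congr_of_eventuallyEq ?_
    filter_upwards [Ioi_mem_nhds hr] with t ht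
    have := norm_sq_eq (pol t (s t))
    rw [norm_pol (pos_of_milnorRadius_lt ht).le] at this
    exact this
  have e1 := hnorm.unique (by simpa using hasDerivAt_pow 2 r)
  have e2 := norm_sq_eq (pol r (s r))
  rw [norm_pol hr0.le] at e2
  have e3 := mem_milnorSet_iff.1 (hs.2 r hr)
  rw [value_angDeriv] at e3
  refine (hasDerivAt_value_comp f (hi 0) (hi 1)).congr_deriv ?_
  rw [value_radDeriv, eq_div_iff hr0.ne']
  apply mul_left_cancel₀ hr0.ne'
  generalize pol r (s r) 0 = x at *
  generalize pol r (s r) 1 = y at *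
  generalize value (pderiv 0 f) (pol r (s r)) = p at *
  generalize value (pderiv 1 f) (pol r (s r)) = q at *
  linear_combination (p * v 0 + q * v 1) * e2 + (x * p + y * q) / 2 * e1 +
    (x * v 1 - y * v 0) * e3

lemma forall_pos_or_forall_neg {u : ℝ → ℝ} {B : ℝ} (hu : ContinuousOn u (Set.Ioi B))
    (h : ∀ r > B, u r ≠ 0) : (∀ r > B, 0 < u r) ∨ ∀ r > B, u r < 0 := by
  by_contra! hcon
  obtain ⟨⟨a, ha, hua⟩, b, hb, hub⟩ := hcon
  obtain ⟨c, hc, huc⟩ := isPreconnected_Ioi.intermediate_value₂ (Set.mem_Ioi.2 ha)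
    (Set.mem_Ioi.2 hb) hu continuousOn_const hua hub
  exact h c hc huc

/-- Far from the origin, `f` is strictly increasing or nonincreasing along a branch: the radial
derivative either vanishes identically there or has no zero. -/
lemma IsBranch.strictMonoOn_or_antitoneOn {f : Poly} (hf : IsPrimitive f) {s : ℝ → ℝ}
    (hs : IsBranch f s) : ∃ B ≥ milnorRadius f,
      StrictMonoOn (fun r => value f (pol r (s r))) (Set.Ioi B) ∨
      AntitoneOn (fun r => value f (pol r (s r))) (Set.Ioi B) := by
  obtain ⟨g₁, g₂, B₀, hJ, h₁, h₂⟩ := exists_splitting (jac_ne_zero hf) (radDeriv f)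
  refine ⟨max (milnorRadius f) B₀, le_max_left _ _, ?_⟩
  set B := max (milnorRadius f) B₀
  have hBR : ∀ {r}, B < r → milnorRadius f < r := fun h => (le_max_left _ _).trans_lt h
  have hcont : ∀ p : Poly, ContinuousOn (fun r => value p (pol r (s r))) (Set.Ioi B) := fun p =>
    (continuous_value p).comp_continuousOn (hs.continuousOn_pol.mono fun r hr => hBR hr)
  have hne : ∀ r > B, value g₂ (pol r (s r)) = 0 → value (radDeriv f) (pol r (s r)) ≠ 0 := by
    intro r hr h h'
    have := h₂ _ h h'
    rw [norm_pol (pos_of_milnorRadius_lt (hBR hr)).le] at this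
    exact this.not_gt ((le_max_right _ _).trans_lt hr)
  have hor : ∀ r > B, value g₁ (pol r (s r)) = 0 ∨ value g₂ (pol r (s r)) = 0 := fun r hr =>
    hJ _ (hs.2 r (hBR hr))
  have hsign : (∀ r > B, 0 < value (radDeriv f) (pol r (s r))) ∨
      ∀ r > B, value (radDeriv f) (pol r (s r)) ≤ 0 := by
    -- On the branch exactly one of `g₁`, `g₂` vanishes, and continuity makes it always the same.
    rcases forall_pos_or_forall_neg (((hcont g₁).pow 2).sub ((hcont g₂).pow 2)) (fun r hr h => by
      simp only [Pi.sub_apply, Pi.pow_apply] at h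
      have hz : value g₁ (pol r (s r)) = 0 ∧ value g₂ (pol r (s r)) = 0 := by
        rcases hor r hr with h0 | h0 <;> rw [h0] at h ⊢ <;> simpa using h
      exact hne r hr hz.2 (h₁ _ hz.1)) with hpos | hneg
    · have hE : ∀ r > B, value (radDeriv f) (pol r (s r)) ≠ 0 := fun r hr => by
        refine hne r hr ((hor r hr).resolve_left fun h0 => ?_)
        have := hpos r hr
        simp only [Pi.sub_apply, Pi.pow_apply] at this
        rw [h0] at this
        nlinarith [sq_nonneg (value g₂ (pol r (s r)))]
      exact (forall_pos_or_forall_neg (hcont _) hE).imp_right fun h r hr => (h r hr).le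
    · refine .inr fun r hr => (h₁ _ ((hor r hr).resolve_right fun h0 => ?_)).le
      have := hneg r hr
      simp only [Pi.sub_apply, Pi.pow_apply] at this
      rw [h0] at this
      nlinarith [sq_nonneg (value g₁ (pol r (s r)))]
  have hderiv : ∀ r > B, deriv (fun r => value f (pol r (s r))) r =
      value (radDeriv f) (pol r (s r)) / r := fun r hr => (hs.hasDerivAt_value hf (hBR hr)).deriv
  refine hsign.imp (fun h => ?_) fun h => ?_
  · refine strictMonoOn_of_deriv_pos (convex_Ioi B) (hcont f) fun r hr => ?_
    rw [interior_Ioi] at hr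
    rw [hderiv r hr]
    exact div_pos (h r hr) (pos_of_milnorRadius_lt (hBR hr))
  · refine antitoneOn_of_deriv_nonpos (convex_Ioi B) (hcont f) (fun r hr => ?_) fun r hr => ?_
    · rw [interior_Ioi] at hr
      exact (hs.hasDerivAt_value hf (hBR hr)).differentiableAt.differentiableWithinAt
    · rw [interior_Ioi] at hr
      rw [hderiv r hr]
      exact div_nonpos_of_nonpos_of_nonneg (h r hr) (pos_of_milnorRadius_lt (hBR hr)).le

lemma pol_eq_of_arc_eq {f : Poly} {s s' : ℝ → ℝ} (h : arc f s = arc f s') {r : ℝ}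
    (hr : milnorRadius f < r) : pol r (s' r) = pol r (s r) := by
  obtain ⟨k, hk⟩ := exists_int_of_arc_eq h hr
  rw [hk, pol_add_int_mul_two_pi]

/-- The condition that `f` increases to `a` along an arc may be tested in the parametrization of
the arc by the distance to the origin. -/
lemma IsBranch.increasesTo_iff {f : Poly} (hf : IsPrimitive f) {s : ℝ → ℝ} (hs : IsBranch f s)
    {a : ℝ} : IncreasesTo f (arc f s) a ↔
      (∃ B ≥ milnorRadius f, StrictMonoOn (fun r => value f (pol r (s r))) (Set.Ioi B)) ∧
        Tendsto (fun r => value f (pol r (s r))) atTop (𝓝 a) := by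
  constructor
  · rintro ⟨c, ⟨-, -, hcim, hcinf⟩, ⟨s₀, hs₀, hmono⟩, hlim⟩
    set h := fun r => value f (pol r (s r)) with hh
    have hval : ∀ u > milnorRadius f, value f (c u) = h ‖c u‖ := by
      intro u hu
      have := mem_arc_iff.1 (hcim ▸ Set.mem_image_of_mem c hu : c u ∈ arc f s)
      rw [hh]
      exact congrArg (value f) this.2
    obtain ⟨B, hB, hB'⟩ := hs.strictMonoOn_or_antitoneOn hf
    -- The distance to the origin need not be known to be monotone in the parameter `u`: it suffices
    -- that it tends to infinity.
    have hstrict : StrictMonoOn h (Set.Ioi B) := by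
      refine hB'.resolve_right fun hanti => ?_
      obtain ⟨u₁, hu₁, hu₁s⟩ := ((hcinf.eventually_gt_atTop B).and (eventually_gt_atTop s₀)).exists
      obtain ⟨u₂, hu₂, hu₂s⟩ :=
        ((hcinf.eventually_ge_atTop ‖c u₁‖).and (eventually_gt_atTop u₁)).exists
      have h1 := hanti hu₁ (Set.mem_Ioi.2 (lt_of_lt_of_le hu₁ hu₂)) hu₂
      have h2 := hmono (Set.mem_Ioi.2 hu₁s) (Set.mem_Ioi.2 (hu₁s.trans hu₂s)) hu₂s
      simp only at h2
      rw [hval _ (hs₀.trans hu₁s), hval _ (hs₀.trans (hu₁s.trans hu₂s))] at h2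
      exact h1.not_gt h2
    refine ⟨⟨B, hB, hstrict⟩, tendsto_order.2 ⟨fun b hb => ?_, fun b hb => ?_⟩⟩
    · obtain ⟨u, hu, huB, huR⟩ := (((tendsto_order.1 hlim).1 b hb).and
        ((hcinf.eventually_gt_atTop B).and (eventually_gt_atTop (milnorRadius f)))).exists
      filter_upwards [eventually_gt_atTop ‖c u‖] with r hr
      rw [hval u huR] at hu
      exact hu.trans (hstrict huB (Set.mem_Ioi.2 (lt_trans huB hr)) hr)
    · filter_upwards [eventually_gt_atTop B] with r hr
      obtain ⟨u, hu, hur, huR⟩ := (((tendsto_order.1 hlim).2 b hb).and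
        ((hcinf.eventually_gt_atTop r).and (eventually_gt_atTop (milnorRadius f)))).exists
      rw [hval u huR] at hu
      exact (hstrict hr (Set.mem_Ioi.2 (lt_trans hr hur)) hur).trans hu
  · rintro ⟨⟨B, hB, hmono⟩, hlim⟩
    have hnorm : ∀ r > milnorRadius f, ‖pol r (s r)‖ = r := fun r hr =>
      norm_pol (pos_of_milnorRadius_lt hr).le _
    refine ⟨fun r => pol r (s r), ⟨hs.continuousOn_pol, fun r hr r' hr' h => ?_, rfl, ?_⟩,
      ⟨B + 1, by linarith, hmono.mono (Set.Ioi_subset_Ioi (by linarith))⟩, hlim⟩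
    · rw [← hnorm r hr, ← hnorm r' hr']
      exact congrArg norm h
    · refine tendsto_id.congr' ?_
      filter_upwards [eventually_gt_atTop (milnorRadius f)] with r hr
      exact (hnorm r hr).symm

/-- If `f` does not increase to `a` along a branch, then far from the origin its values on the
branch avoid an interval `]a - ε, a[`. -/
lemma IsBranch.exists_gap {f : Poly} (hf : IsPrimitive f) {s : ℝ → ℝ} (hs : IsBranch f s) {a : ℝ}
    (ha : ¬ IncreasesTo f (arc f s) a) : ∃ B ≥ milnorRadius f, ∃ ε > 0,
      ∀ r > B, value f (pol r (s r)) ∉ Set.Ioo (a - ε) a := by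
  obtain ⟨B, hB, hmono | hanti⟩ := hs.strictMonoOn_or_antitoneOn hf
  · by_cases hex : ∃ r₁ > B, a ≤ value f (pol r₁ (s r₁))
    · obtain ⟨r₁, hr₁, hle⟩ := hex
      exact ⟨r₁, hB.le.trans hr₁.le, 1, one_pos, fun r hr h =>
        (hle.trans_lt (hmono hr₁ (Set.mem_Ioi.2 (lt_trans hr₁ hr)) hr)).not_gt h.2⟩
    · push Not at hex
      by_contra! hno
      refine ha ((hs.increasesTo_iff hf).2 ⟨⟨B, hB, hmono⟩, tendsto_order.2
        ⟨fun b hb => ?_, fun b hb => ?_⟩⟩)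
      · obtain ⟨r₁, hr₁, hI⟩ := hno B hB (a - b) (sub_pos.2 hb)
        filter_upwards [eventually_gt_atTop r₁] with r hr
        have := hmono hr₁ (Set.mem_Ioi.2 (lt_trans hr₁ hr)) hr
        simp only at this
        linarith [hI.1]
      · filter_upwards [eventually_gt_atTop B] with r hr
        exact (hex r hr).trans hb
  · by_cases hex : ∃ r₁ > B, value f (pol r₁ (s r₁)) < a
    · obtain ⟨r₁, hr₁, hlt⟩ := hex
      refine ⟨r₁, hB.le.trans hr₁.le, a - value f (pol r₁ (s r₁)), sub_pos.2 hlt, fun r hr h => ?_⟩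
      have := hanti hr₁ (Set.mem_Ioi.2 (lt_trans hr₁ hr)) (le_of_lt hr)
      simp only at this
      linarith [h.1]
    · push Not at hex
      exact ⟨B, hB, 1, one_pos, fun r hr h => (hex r hr).not_gt h.2⟩

/-- The two possible behaviours of `f` along an arc, with thresholds `B`, `ε` that depend only on
the arc. -/
lemma exists_tail {f : Poly} (hf : IsPrimitive f) (a : ℝ) {γ : Set Plane} (hγ : γ ∈ milnorArcs f) :
    ∃ B ε : ℝ, milnorRadius f ≤ B ∧ 0 < ε ∧ ∀ s, IsBranch f s → γ = arc f s →
      (IncreasesTo f γ a → StrictMonoOn (fun r => value f (pol r (s r))) (Set.Ioi B) ∧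
        Tendsto (fun r => value f (pol r (s r))) atTop (𝓝 a)) ∧
      (¬ IncreasesTo f γ a → ∀ r > B, value f (pol r (s r)) ∉ Set.Ioo (a - ε) a) := by
  obtain ⟨s, hs, rfl⟩ := (mem_milnorArcs_iff hf).1 hγ
  by_cases ha : IncreasesTo f (arc f s) a
  · obtain ⟨⟨B, hB, hmono⟩, -⟩ := (hs.increasesTo_iff hf).1 ha
    refine ⟨B, 1, hB, one_pos, fun u hu hsu => ⟨fun _ => ⟨?_, ?_⟩, fun h => absurd ha h⟩⟩
    · refine hmono.congr fun r hr => ?_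
      simp only [pol_eq_of_arc_eq hsu (lt_of_le_of_lt hB hr)]
    · rw [hsu] at ha
      exact ((hu.increasesTo_iff hf).1 ha).2
  · obtain ⟨B, hB, ε, hε, hgap⟩ := hs.exists_gap hf ha
    refine ⟨B, ε, hB, hε, fun u hu hsu => ⟨fun h => absurd h ha, fun _ r hr => ?_⟩⟩
    rw [pol_eq_of_arc_eq hsu (lt_of_le_of_lt hB hr)]
    exact hgap r hr

/-! ### The fibre between two successive branches -/

/-- A level set meeting every vertical segment of a rectangle exactly once is connected. -/
lemma isPreconnected_levelSet {G : ℝ × ℝ → ℝ} {r₁ r₂ t : ℝ}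
    (hG : ContinuousOn G (Set.Icc r₁ r₂ ×ˢ Set.Icc 0 1))
    (h : ∀ r ∈ Set.Icc r₁ r₂, ∃! u, u ∈ Set.Icc (0 : ℝ) 1 ∧ G (r, u) = t) :
    IsPreconnected {z | z ∈ Set.Icc r₁ r₂ ×ˢ Set.Icc (0 : ℝ) 1 ∧ G z = t} := by
  set Z := {z | z ∈ Set.Icc r₁ r₂ ×ˢ Set.Icc (0 : ℝ) 1 ∧ G z = t}
  have hZ : IsCompact Z := by
    refine (isCompact_Icc.prod isCompact_Icc).of_isClosed_subset
      (hG.preimage_isClosed_of_isClosed (isClosed_Icc.prod isClosed_Icc) (isClosed_singleton (x := t)))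
      fun z hz => hz.1
  have := isCompact_iff_compactSpace.1 hZ
  let p : Z → Set.Icc r₁ r₂ := fun z => ⟨z.1.1, z.2.1.1⟩
  have hp : Continuous p := (continuous_fst.comp continuous_subtype_val).subtype_mk _
  have hinj : Function.Injective p := by
    rintro ⟨⟨r, u⟩, hz, hzt⟩ ⟨⟨r', u'⟩, hz', hzt'⟩ hpp
    obtain rfl : r = r' := congrArg Subtype.val hpp
    have := (h r hz.1).unique ⟨hz.2, hzt⟩ ⟨hz'.2, hzt'⟩
    subst this
    rfl
  have hsurj : Set.univ ⊆ Set.range p := by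
    rintro ⟨r, hr⟩ -
    obtain ⟨u, ⟨hu, hut⟩, -⟩ := h r hr
    exact ⟨⟨(r, u), ⟨hr, hu⟩, hut⟩, rfl⟩
  have : PreconnectedSpace (Set.Icc r₁ r₂) :=
    isPreconnected_iff_preconnectedSpace.1 isPreconnected_Icc
  have := (isPreconnected_univ.preimage_of_isClosedMap hinj hp.isClosedMap hsurj).image
    Subtype.val continuous_subtype_val.continuousOn
  simpa using this

/-- If `f` is strictly increasing along two successive branches and takes the value `t` on both
outside the disk of radius `R`, then the fibre over `t` in the sector between them is an arc that
joins the two points. -/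
lemma IsNext.connectedComponentIn_eq {f : Poly} {s s' : ℝ → ℝ} (h : IsNext f s s') {B R t : ℝ}
    (hB : milnorRadius f ≤ B) (hBR : B < R)
    (hs : StrictMonoOn (fun r => value f (pol r (s r))) (Set.Ioi B))
    (hs' : StrictMonoOn (fun r => value f (pol r (s' r))) (Set.Ioi B)) {r₁ r₂ : ℝ} (hr₁ : R < r₁)
    (hr₂ : R < r₂) (h₁ : value f (pol r₁ (s r₁)) = t) (h₂ : value f (pol r₂ (s' r₂)) = t) :
    connectedComponentIn (fibreOutside f R t) (pol r₁ (s r₁)) =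
      connectedComponentIn (fibreOutside f R t) (pol r₂ (s' r₂)) := by
  set I := Set.uIcc r₁ r₂ with hI
  have hIR : ∀ r ∈ I, R < r := fun r hr => (lt_inf_iff.2 ⟨hr₁, hr₂⟩).trans_le hr.1
  have hIR₀ : ∀ r ∈ I, milnorRadius f < r := fun r hr => hB.trans_lt (hBR.trans (hIR r hr))
  -- The closed sector is parametrized by `(r, u)` with `u ∈ [0, 1]`.
  let m : ℝ × ℝ → Plane := fun z => pol z.1 (s z.1 + z.2 * (s' z.1 - s z.1))
  have hm : ContinuousOn m (I ×ˢ Set.Icc 0 1) := by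
    have hfst : Set.MapsTo Prod.fst (I ×ˢ Set.Icc (0 : ℝ) 1) (Set.Ioi (milnorRadius f)) :=
      fun z hz => hIR₀ z.1 hz.1
    have c1 := h.left.1.comp continuousOn_fst hfst
    have c2 := h.right.1.comp continuousOn_fst hfst
    exact continuous_pol.comp_continuousOn
      (continuousOn_fst.prodMk (c1.add (continuousOn_snd.mul (c2.sub c1))))
  have huniq : ∀ r ∈ I, ∃! u, u ∈ Set.Icc (0 : ℝ) 1 ∧ (value f ∘ m) (r, u) = t := by
    intro r hr
    have hrB : r ∈ Set.Ioi B := hBR.trans (hIR r hr)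
    have hlt := h.lt (hIR₀ r hr)
    have hc : Continuous fun u => (value f ∘ m) (r, u) :=
      (continuous_value f).comp (continuous_pol.comp (by fun_prop :
        Continuous fun u : ℝ => (r, s r + u * (s' r - s r))))
    have m0 : (value f ∘ m) (r, 0) = value f (pol r (s r)) := by simp [m]
    have m1 : (value f ∘ m) (r, 1) = value f (pol r (s' r)) := by simp [m]
    have hmem : t ∈ Set.uIcc ((value f ∘ m) (r, 0)) ((value f ∘ m) (r, 1)) := by
      rw [m0, m1, Set.mem_uIcc]
      have hr₁B : r₁ ∈ Set.Ioi B := hBR.trans hr₁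
      have hr₂B : r₂ ∈ Set.Ioi B := hBR.trans hr₂
      rcases Set.mem_uIcc.1 hr with ⟨ha, hb⟩ | ⟨ha, hb⟩
      · exact .inr ⟨h₂ ▸ hs'.monotoneOn hrB hr₂B hb, h₁ ▸ hs.monotoneOn hr₁B hrB ha⟩
      · exact .inl ⟨h₁ ▸ hs.monotoneOn hrB hr₁B hb, h₂ ▸ hs'.monotoneOn hr₂B hrB ha⟩
    obtain ⟨u, hu, hut⟩ := intermediate_value_uIcc hc.continuousOn hmem
    rw [Set.uIcc_of_le zero_le_one] at hu
    refine ⟨u, ⟨hu, hut⟩, ?_⟩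
    -- Two solutions would give, by Rolle's theorem, a point of `M(f)` between the branches.
    have hroll : ∀ u v : ℝ, 0 ≤ u → v ≤ 1 → u < v → (value f ∘ m) (r, u) ≠ (value f ∘ m) (r, v) := by
      intro u v hu hv huv heq
      obtain ⟨φ, ⟨hφ1, hφ2⟩, hφ⟩ := exists_hasDerivAt_eq_zero
        (f := fun θ => value f (pol r θ)) (f' := fun θ => value (angDeriv f) (pol r θ))
        (a := s r + u * (s' r - s r)) (b := s r + v * (s' r - s r)) (by nlinarith)
        (fun θ _ => (hasDerivAt_value_pol f r θ).continuousAt.continuousWithinAt) heq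
        fun θ _ => hasDerivAt_value_pol f r θ
      exact h.notMem (hIR₀ r hr) (by nlinarith) (by nlinarith) (mem_milnorSet_iff.2 hφ)
    rintro v ⟨hv, hvt⟩
    rcases lt_trichotomy u v with hlt' | heq | hlt'
    · exact absurd (hut.trans hvt.symm) (hroll u v hu.1 hv.2 hlt')
    · exact heq.symm
    · exact absurd (hvt.trans hut.symm) (hroll v u hv.1 hu.2 hlt')
  have hpre := (isPreconnected_levelSet ((continuous_value f).comp_continuousOn hm) huniq).image m
    (hm.mono fun z hz => hz.1)
  have hsub : m '' {z | z ∈ I ×ˢ Set.Icc (0 : ℝ) 1 ∧ (value f ∘ m) z = t} ⊆ fibreOutside f R t := by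
    rintro _ ⟨z, ⟨hz, hzt⟩, rfl⟩
    refine ⟨?_, hzt⟩
    rw [mem_closedBall_zero_iff, norm_pol (pos_of_milnorRadius_lt (hIR₀ z.1 hz.1)).le, not_le]
    exact hIR z.1 hz.1
  have hmem₁ : pol r₁ (s r₁) ∈ m '' {z | z ∈ I ×ˢ Set.Icc (0 : ℝ) 1 ∧ (value f ∘ m) z = t} := by
    refine ⟨(r₁, 0), ⟨⟨Set.left_mem_uIcc, by simp⟩, ?_⟩, ?_⟩ <;> simp [m, h₁]
  have hmem₂ : pol r₂ (s' r₂) ∈ m '' {z | z ∈ I ×ˢ Set.Icc (0 : ℝ) 1 ∧ (value f ∘ m) z = t} := by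
    refine ⟨(r₂, 1), ⟨⟨Set.right_mem_uIcc, by simp⟩, ?_⟩, ?_⟩ <;> simp [m, h₂]
  exact _root_.connectedComponentIn_eq (hpre.subset_connectedComponentIn hmem₁ hsub hmem₂)

/-! ### Separation of the fibre by the remaining arcs -/

/-- The polar coordinate map is open at positive radii, as `exp` is open. -/
lemma nhds_pol_le {r : ℝ} (hr : 0 < r) (θ : ℝ) :
    𝓝 (pol r θ) ≤ Filter.map (fun z : ℝ × ℝ => pol z.1 z.2) (𝓝 (r, θ)) := by
  intro N hN
  rw [Filter.mem_map] at hN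
  let m : ℂ → ℝ × ℝ := fun z => (Real.exp z.re, z.im)
  have hm : Continuous m := by fun_prop
  have hm₀ : m ⟨Real.log r, θ⟩ = (r, θ) := by simp [m, Real.exp_log hr]
  have h1 := hm.continuousAt.preimage_mem_nhds (hm₀ ▸ hN)
  have h2 := Complex.isOpenMap_exp.image_mem_nhds h1
  let c : Plane → ℂ := fun x => (x 0 : ℂ) + (x 1 : ℂ) * Complex.I
  have hc : Continuous c := by fun_prop
  have hc₀ : c (pol r θ) = Complex.exp ⟨Real.log r, θ⟩ := by
    apply Complex.ext
    · rw [Complex.exp_re]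
      simp [c, Real.exp_log hr, Complex.cos_ofReal_re]
    · rw [Complex.exp_im]
      simp [c, Real.exp_log hr, Complex.sin_ofReal_re]
  filter_upwards [hc.continuousAt.preimage_mem_nhds (hc₀ ▸ h2)] with x hx
  obtain ⟨z, hz, hzx⟩ := hx
  have hxz : x = pol (Real.exp z.re) z.im := by
    ext i
    fin_cases i
    · have := congrArg Complex.re hzx
      rw [Complex.exp_re] at this
      simpa [c] using this.symm
    · have := congrArg Complex.im hzx
      rw [Complex.exp_im] at this
      simpa [c] using this.symm
  rw [hxz]
  exact hz

/-- The union of the half-open sectors that are bounded clockwise by an arc of the family `T`. -/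
def sectors (f : Poly) (T : Set (Set Plane)) : Set Plane :=
  {x | ∃ r θ s s', milnorRadius f < r ∧ x = pol r θ ∧ IsNext f s s' ∧ s r ≤ θ ∧ θ < s' r ∧
    arc f s ∈ T}

lemma IsNext.pol_mem_sectors_iff {f : Poly} (hf : IsPrimitive f) {s s' : ℝ → ℝ}
    (h : IsNext f s s') {T : Set (Set Plane)} {r θ : ℝ} (hr : milnorRadius f < r) (h1 : s r ≤ θ)
    (h2 : θ < s' r) : pol r θ ∈ sectors f T ↔ arc f s ∈ T := by
  constructor
  · rintro ⟨r', θ', u, u', hr', hp, hu, h3, h4, hT⟩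
    rwa [h.arc_eq_of_pol_eq hf hu hr hr' hp h1 h2 h3 h4]
  · exact fun hT => ⟨r, θ, s, s', hr, rfl, h, h1, h2, hT⟩

lemma IsBranch.mem_sectors_iff {f : Poly} (hf : IsPrimitive f) {s : ℝ → ℝ} (hs : IsBranch f s)
    {T : Set (Set Plane)} {x : Plane} (hx : x ∈ arc f s) : x ∈ sectors f T ↔ arc f s ∈ T := by
  obtain ⟨r, hr, rfl⟩ := hx
  obtain ⟨s', h⟩ := exists_isNext hf hs
  exact h.pol_mem_sectors_iff hf hr le_rfl (h.lt hr)

/-- Membership in `sectors f T` is locally constant on a set `F` as soon as, whenever an arc meets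
`F`, this arc and its antecedent are both in `T` or both outside `T`. -/
lemma eventually_mem_sectors_iff {f : Poly} (hf : IsPrimitive f) {s₀ : ℝ → ℝ}
    (hs₀ : IsBranch f s₀) {T : Set (Set Plane)} {F : Set Plane}
    (hF : ∀ x ∈ F, milnorRadius f < ‖x‖)
    (hT : ∀ s s', IsNext f s s' → (F ∩ arc f s').Nonempty → (arc f s ∈ T ↔ arc f s' ∈ T))
    {x : Plane} (hx : x ∈ F) : ∀ᶠ y in 𝓝 x, y ∈ sectors f T ↔ x ∈ sectors f T := by
  obtain ⟨θ, hθ⟩ := exists_eq_pol x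
  set r := ‖x‖
  have hr : milnorRadius f < r := hF x hx
  obtain ⟨s, s', h, h1, h2⟩ := exists_isNext_locate hf hs₀ hr θ
  have key : ∀ u, IsBranch f u →
      Tendsto (fun z : ℝ × ℝ => u z.1) (𝓝 (r, θ)) (𝓝 (u r)) := fun u hu =>
    (hu.1.continuousAt (Ioi_mem_nhds hr)).tendsto.comp continuous_fst.continuousAt
  have hsnd : Tendsto (fun z : ℝ × ℝ => z.2) (𝓝 (r, θ)) (𝓝 θ) := continuous_snd.continuousAt
  have hfst : ∀ᶠ z : ℝ × ℝ in 𝓝 (r, θ), milnorRadius f < z.1 :=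
    continuous_fst.continuousAt.eventually (Ioi_mem_nhds hr)
  have hright : ∀ᶠ z : ℝ × ℝ in 𝓝 (r, θ), z.2 < s' z.1 := hsnd.eventually_lt (key s' h.right) h2
  rw [hθ, h.pol_mem_sectors_iff hf hr h1 h2]
  refine nhds_pol_le (pos_of_milnorRadius_lt hr) θ ?_
  rw [Filter.mem_map]
  -- A point off the arc of `s` has neighbours only in the sector from `s` to `s'`; a point on it also
  -- has neighbours in the sector that ends at `s`.
  rcases h1.lt_or_eq with hlt | heq
  · filter_upwards [hfst, hright, (key s h.left).eventually_lt hsnd hlt] with z hz1 hz2 hz3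
    exact h.pol_mem_sectors_iff hf hz1 hz3.le hz2
  · obtain ⟨u, hu⟩ := exists_isPrev hf h.left
    have hiff := hT u s hu ⟨x, hx, r, hr, by simp only [heq, ← hθ]⟩
    have hlt : u r < θ := heq ▸ hu.lt hr
    filter_upwards [hfst, hright, (key u hu.left).eventually_lt hsnd hlt] with z hz1 hz2 hz3
    by_cases hz : s z.1 ≤ z.2
    · exact h.pol_mem_sectors_iff hf hz1 hz hz2
    · exact (hu.pol_mem_sectors_iff hf hz1 hz3.le (not_le.1 hz)).trans hiff

/-- A connected component of the fibre stays in a union of sectors whose boundary arcs it does not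
meet. -/
lemma arc_mem_of_mem_connectedComponentIn {f : Poly} (hf : IsPrimitive f) {T : Set (Set Plane)}
    {F : Set Plane} (hF : ∀ x ∈ F, milnorRadius f < ‖x‖)
    (hT : ∀ s s', IsNext f s s' → (F ∩ arc f s').Nonempty → (arc f s ∈ T ↔ arc f s' ∈ T))
    {s u : ℝ → ℝ} (hs : IsBranch f s) (hu : IsBranch f u) {p q : Plane} (hp : p ∈ arc f s)
    (hpT : arc f s ∈ T) (hq : q ∈ arc f u) (hpF : p ∈ F) (hpq : q ∈ connectedComponentIn F p) :
    arc f u ∈ T := by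
  by_contra hqT
  rw [← hs.mem_sectors_iff hf hp] at hpT
  rw [← hu.mem_sectors_iff hf hq] at hqT
  have hloc := fun x (hx : x ∈ F) => eventually_mem_sectors_iff hf hs hF hT hx
  have hsub := connectedComponentIn_subset F p
  obtain ⟨x, hx, hx1, hx2⟩ := isPreconnected_connectedComponentIn (F := F) (x := p)
    {x | ∀ᶠ y in 𝓝 x, y ∈ sectors f T} {x | ∀ᶠ y in 𝓝 x, y ∉ sectors f T}
    isOpen_setOfPred_eventually_nhds isOpen_setOfPred_eventually_nhds
    (fun x hx => by
      by_cases hxT : x ∈ sectors f T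
      · exact .inl ((hloc x (hsub hx)).mono fun y hy => hy.2 hxT)
      · exact .inr ((hloc x (hsub hx)).mono fun y hy => fun h => hxT (hy.1 h)))
    ⟨p, mem_connectedComponentIn hpF, (hloc p hpF).mono fun y hy => hy.2 hpT⟩
    ⟨q, hpq, (hloc q (hsub hpq)).mono fun y hy => fun h => hqT (hy.1 h)⟩
  exact hx2.self_of_nhds hx1.self_of_nhds

/-! ### Clusters -/

lemma IsConsecutive.right_unique {f : Poly} (hf : IsPrimitive f) {γ δ δ' : Set Plane}
    (hγ : γ ∈ milnorArcs f) (hδ : δ ∈ milnorArcs f) (hδ' : δ' ∈ milnorArcs f)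
    (h : IsConsecutive f γ δ) (h' : IsConsecutive f γ δ') : δ = δ' := by
  obtain ⟨s, s', hs, rfl, rfl⟩ := h.exists_isNext hf hγ hδ
  obtain ⟨u, u', hu, heq, rfl⟩ := h'.exists_isNext hf hγ hδ'
  exact hs.arc_right_eq hf hu heq

lemma IsConsecutive.left_unique {f : Poly} (hf : IsPrimitive f) {γ γ' δ : Set Plane}
    (hγ : γ ∈ milnorArcs f) (hγ' : γ' ∈ milnorArcs f) (hδ : δ ∈ milnorArcs f)
    (h : IsConsecutive f γ δ) (h' : IsConsecutive f γ' δ) : γ = γ' := by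
  obtain ⟨s, s', hs, rfl, rfl⟩ := h.exists_isNext hf hγ hδ
  obtain ⟨u, u', hu, rfl, heq⟩ := h'.exists_isNext hf hγ' hδ
  exact hs.arc_left_eq hf hu heq

namespace IsIncreasingCluster

variable {f : Poly} {a : ℝ} {C C' : List (Set Plane)}

lemma head_mem_milnorArcs (hC : IsIncreasingCluster f a C) :
    C.head hC.ne_nil ∈ milnorArcs f :=
  hC.arcs _ (List.head_mem _)

/-- The consecutive of an arc of a cluster lies in the cluster if `f` increases to `a` along it. -/
lemma mem_of_isConsecutive (hf : IsPrimitive f) (hC : IsIncreasingCluster f a C) {γ δ : Set Plane}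
    (hγ : γ ∈ C) (hδ : δ ∈ milnorArcs f) (h : IsConsecutive f γ δ) (ha : IncreasesTo f δ a) :
    δ ∈ C := by
  have main : ∀ (l : List (Set Plane)) (hl : l ≠ []), (∀ γ ∈ l, γ ∈ milnorArcs f) →
      l.IsChain (IsConsecutive f) → ¬ IsConsecutive f (l.getLast hl) δ → γ ∈ l → δ ∈ l := by
    intro l
    induction l with
    | nil => exact fun hl => absurd rfl hl
    | cons x l ih =>
      intro hl harcs hchain hlast hγ
      rcases l with _ | ⟨y, l⟩
      · obtain rfl : γ = x := by simpa using hγ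
        exact absurd h (by simpa using hlast)
      · rw [List.isChain_cons_cons] at hchain
        rcases List.mem_cons.1 hγ with rfl | hγ
        · have : y = δ := hchain.1.right_unique hf (harcs _ (by simp)) (harcs _ (by simp)) hδ h
          simp [this]
        · exact List.mem_cons_of_mem _ (ih (by simp) (fun z hz => harcs z (List.mem_cons_of_mem _ hz))
            hchain.2 (by simpa using hlast) hγ)
  exact main C hC.ne_nil hC.arcs hC.chain (fun h' => hC.consecutive δ hδ h' ha) hγ

lemma eq_head_or_exists_isConsecutive (hC : IsIncreasingCluster f a C) {γ : Set Plane}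
    (hγ : γ ∈ C) : γ = C.head hC.ne_nil ∨ ∃ δ ∈ C, IsConsecutive f δ γ := by
  have main : ∀ (l : List (Set Plane)) (hl : l ≠ []), l.IsChain (IsConsecutive f) → γ ∈ l →
      γ = l.head hl ∨ ∃ δ ∈ l, IsConsecutive f δ γ := by
    intro l
    induction l with
    | nil => exact fun hl => absurd rfl hl
    | cons x l ih =>
      intro hl hchain hγ
      rcases List.mem_cons.1 hγ with rfl | hγ
      · exact .inl rfl
      · rcases l with _ | ⟨y, l⟩
        · simp at hγ
        · rw [List.isChain_cons_cons] at hchain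
          right
          rcases ih (by simp) hchain.2 hγ with h | ⟨δ, hδ, h⟩
          · rw [List.head_cons] at h
            exact ⟨x, by simp, h ▸ hchain.1⟩
          · exact ⟨δ, List.mem_cons_of_mem _ hδ, h⟩
  exact main C hC.ne_nil hC.chain hγ

/-- A cluster whose first arc lies in another cluster has the same first arc. -/
lemma head_eq_of_mem (hC : IsIncreasingCluster f a C) (hC' : IsIncreasingCluster f a C')
    (h : C'.head hC'.ne_nil ∈ C) : C'.head hC'.ne_nil = C.head hC.ne_nil :=
  (hC.eq_head_or_exists_isConsecutive h).resolve_right fun ⟨δ, hδ, hcons⟩ =>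
    hC'.antecedent δ (hC.arcs δ hδ) hcons (hC.increases δ hδ)

/-- A cluster is determined by its first arc. -/
lemma eq_of_head_eq (hf : IsPrimitive f) (hC : IsIncreasingCluster f a C)
    (hC' : IsIncreasingCluster f a C') (h : C.head hC.ne_nil = C'.head hC'.ne_nil) : C = C' := by
  have main : ∀ (l l' : List (Set Plane)) (hl : l ≠ []) (hl' : l' ≠ []),
      l.head hl = l'.head hl' →
      (∀ γ ∈ l, γ ∈ milnorArcs f ∧ IncreasesTo f γ a) →
      (∀ γ ∈ l', γ ∈ milnorArcs f ∧ IncreasesTo f γ a) →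
      l.IsChain (IsConsecutive f) → l'.IsChain (IsConsecutive f) →
      (∀ ν ∈ milnorArcs f, IsConsecutive f (l.getLast hl) ν → ¬ IncreasesTo f ν a) →
      (∀ ν ∈ milnorArcs f, IsConsecutive f (l'.getLast hl') ν → ¬ IncreasesTo f ν a) →
      l = l' := by
    intro l
    induction l with
    | nil => exact fun _ hl => absurd rfl hl
    | cons x l ih =>
      intro l' hl hl' hhead harcs harcs' hchain hchain' hlast hlast'
      obtain ⟨x', l', rfl⟩ := List.exists_cons_of_ne_nil hl'
      obtain rfl : x = x' := hhead
      rcases l with _ | ⟨y, l⟩ <;> rcases l' with _ | ⟨y', l'⟩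
      · rfl
      · rw [List.isChain_cons_cons] at hchain'
        exact absurd (harcs' y' (by simp)).2
          (hlast y' (harcs' y' (by simp)).1 (by simpa using hchain'.1))
      · rw [List.isChain_cons_cons] at hchain
        exact absurd (harcs y (by simp)).2
          (hlast' y (harcs y (by simp)).1 (by simpa using hchain.1))
      · rw [List.isChain_cons_cons] at hchain hchain'
        have hyy : y = y' := hchain.1.right_unique hf (harcs x (by simp)).1 (harcs y (by simp)).1
          (harcs' y' (by simp)).1 hchain'.1
        rw [ih (y' :: l') (by simp) (by simp) hyy
          (fun γ hγ => harcs γ (List.mem_cons_of_mem _ hγ))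
          (fun γ hγ => harcs' γ (List.mem_cons_of_mem _ hγ)) hchain.2 hchain'.2
          (by simpa using hlast) (by simpa using hlast')]
  exact main C C' hC.ne_nil hC'.ne_nil h (fun γ hγ => ⟨hC.arcs γ hγ, hC.increases γ hγ⟩)
    (fun γ hγ => ⟨hC'.arcs γ hγ, hC'.increases γ hγ⟩) hC.chain hC'.chain hC.consecutive
    hC'.consecutive

/-- A quantity that agrees on consecutive arcs of a cluster is constant on the cluster. -/
lemma eq_head_of_forall_isConsecutive {β : Type*} (hC : IsIncreasingCluster f a C)
    {φ : Set Plane → β}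
    (h : ∀ γ ∈ C, ∀ δ ∈ C, IsConsecutive f γ δ → φ γ = φ δ) {γ : Set Plane} (hγ : γ ∈ C) :
    φ γ = φ (C.head hC.ne_nil) := by
  have main : ∀ (l : List (Set Plane)) (hl : l ≠ []), l.IsChain (IsConsecutive f) →
      (∀ γ ∈ l, ∀ δ ∈ l, IsConsecutive f γ δ → φ γ = φ δ) → γ ∈ l → φ γ = φ (l.head hl) := by
    intro l
    induction l with
    | nil => exact fun hl => absurd rfl hl
    | cons x l ih =>
      intro hl hchain h hγ
      rcases List.mem_cons.1 hγ with rfl | hγ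
      · rfl
      · rcases l with _ | ⟨y, l⟩
        · simp at hγ
        · rw [List.isChain_cons_cons] at hchain
          have := ih (by simp) hchain.2 (fun γ hγ δ hδ => h γ (List.mem_cons_of_mem _ hγ) δ
            (List.mem_cons_of_mem _ hδ)) hγ
          rw [this, List.head_cons, List.head_cons]
          exact (h x (by simp) y (by simp) hchain.1).symm
  exact main C hC.ne_nil hC.chain h hγ

/-- The arcs of a cluster together with the antecedent of its first arc form a family to which,
for every arc along which `f` increases to `a`, the arc and its antecedent both belong or both do
not belong. -/
lemma exists_family (hf : IsPrimitive f) (hC : IsIncreasingCluster f a C) :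
    ∃ T : Set (Set Plane), (∀ γ ∈ C, γ ∈ T) ∧ (∀ γ ∈ T, IncreasesTo f γ a → γ ∈ C) ∧
      ∀ s s', IsNext f s s' → IncreasesTo f (arc f s') a → (arc f s ∈ T ↔ arc f s' ∈ T) := by
  have hhead := hC.head_mem_milnorArcs
  obtain ⟨s₀', hs₀', hs₀'eq⟩ := (mem_milnorArcs_iff hf).1 hhead
  obtain ⟨s₀, hs₀⟩ := exists_isPrev hf hs₀'
  have harc : ∀ {u}, IsBranch f u → arc f u ∈ milnorArcs f := fun hu =>
    (mem_milnorArcs_iff hf).2 ⟨_, hu, rfl⟩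
  have hν : ¬ IncreasesTo f (arc f s₀) a :=
    hC.antecedent _ (harc hs₀.left) (hs₀'eq ▸ hs₀.isConsecutive)
  have hT : ∀ γ ∈ {γ | γ ∈ C} ∪ {arc f s₀}, IncreasesTo f γ a → γ ∈ C := by
    rintro γ (h | rfl) hγ
    · exact h
    · exact absurd hγ hν
  refine ⟨{γ | γ ∈ C} ∪ {arc f s₀}, fun γ h => .inl h, hT, fun s s' hs ha => ⟨?_, fun h => ?_⟩⟩
  · rintro (h | h)
    · exact .inl (hC.mem_of_isConsecutive hf h (harc hs.right) hs.isConsecutive ha)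
    · refine .inl ?_
      have : arc f s' ∈ C := by
        rw [hs.arc_right_eq hf hs₀ h, ← hs₀'eq]
        exact List.head_mem _
      exact this
  · rcases hC.eq_head_or_exists_isConsecutive (hT _ h ha) with heq | ⟨δ, hδ, hcons⟩
    · exact .inr (hs.arc_left_eq hf hs₀ (heq.trans hs₀'eq))
    · have : arc f s = δ := hs.isConsecutive.left_unique hf (harc hs.left) (hC.arcs δ hδ)
        (harc hs.right) hcons
      exact .inl (this ▸ hδ)

end IsIncreasingCluster

lemma finite_clusters {f : Poly} (hf : IsPrimitive f) (a : ℝ) :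
    {C | IsIncreasingCluster f a C}.Finite := by
  refine Set.Finite.of_finite_image (f := List.head?)
    (((finite_milnorArcs hf).image some).subset ?_) ?_
  · rintro _ ⟨C, hC, rfl⟩
    have hC : IsIncreasingCluster f a C := hC
    exact ⟨_, hC.head_mem_milnorArcs, (List.head?_eq_some_head hC.ne_nil).symm⟩
  · intro C hC C' hC' h
    have hC : IsIncreasingCluster f a C := hC
    have hC' : IsIncreasingCluster f a C' := hC'
    rw [List.head?_eq_some_head hC.ne_nil, List.head?_eq_some_head hC'.ne_nil] at h
    exact hC.eq_of_head_eq hf hC' (Option.some.inj h)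

/-! ### Points of the fibre on the Milnor arcs -/

/-- For `R` large and `t < a` close to `a`, the fibre over `t` outside the disk of radius `R` meets
each arc along which `f` increases to `a` in exactly one point and no other arc. -/
lemma exists_fibre_structure {f : Poly} (hf : IsPrimitive f) (a : ℝ) :
    ∃ R₁ > milnorRadius f, ∀ R ≥ R₁, ∃ η > 0, ∀ t ∈ Set.Ioo (a - η) a,
      (∀ γ ∈ milnorArcs f, (γ ∩ fibreOutside f R t).Nonempty → IncreasesTo f γ a) ∧
      ∃ P : Set Plane → Plane,
        (∀ γ ∈ milnorArcs f, IncreasesTo f γ a → γ ∩ fibreOutside f R t = {P γ}) ∧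
        ∀ γ ∈ milnorArcs f, ∀ δ ∈ milnorArcs f, IncreasesTo f γ a → IncreasesTo f δ a →
          IsConsecutive f γ δ →
          connectedComponentIn (fibreOutside f R t) (P γ) =
            connectedComponentIn (fibreOutside f R t) (P δ) := by
  classical
  have hfin := finite_milnorArcs hf
  choose! B ε hB hε htail using fun γ (hγ : γ ∈ milnorArcs f) => exists_tail hf a hγ
  choose! σ hσ hσγ using fun γ (hγ : γ ∈ milnorArcs f) => (mem_milnorArcs_iff hf).1 hγ
  obtain ⟨R₁, hR₁⟩ := eventually_atTop.1
    (((Filter.eventually_all_finite hfin).2 fun γ _ => eventually_gt_atTop (B γ)).and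
      (eventually_gt_atTop (milnorRadius f)))
  refine ⟨R₁, (hR₁ R₁ le_rfl).2, fun R hR => ?_⟩
  obtain ⟨hBR, hRR⟩ := hR₁ R hR
  have hlt : ∀ γ ∈ milnorArcs f, IncreasesTo f γ a → value f (pol R (σ γ R)) < a := by
    intro γ hγ ha
    obtain ⟨hmono, hlim⟩ := (htail γ hγ _ (hσ γ hγ) (hσγ γ hγ)).1 ha
    have hR1 : R + 1 ∈ Set.Ioi (B γ) := (hBR γ hγ).trans (lt_add_one R)
    refine lt_of_lt_of_le (hmono (hBR γ hγ) hR1 (lt_add_one R)) (ge_of_tendsto hlim ?_)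
    filter_upwards [eventually_ge_atTop (R + 1)] with r hr
    exact hmono.monotoneOn hR1 (lt_of_lt_of_le hR1 hr) hr
  -- `η` has to be smaller than the gaps of the other arcs, and such that along the arcs on which `f`
  -- increases to `a` the value at radius `R` stays below `a - η`.
  have hsmall : ∀ᶠ η in 𝓝[>] (0 : ℝ), ∀ γ ∈ milnorArcs f, η < ε γ ∧
      (IncreasesTo f γ a → η < a - value f (pol R (σ γ R))) := by
    refine (Filter.eventually_all_finite hfin).2 fun γ hγ => ?_
    have h1 : ∀ᶠ η in 𝓝[>] (0 : ℝ), η < ε γ := by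
      filter_upwards [Ioo_mem_nhdsGT (hε γ hγ)] with η h using h.2
    refine h1.and ?_
    by_cases ha : IncreasesTo f γ a
    · filter_upwards [Ioo_mem_nhdsGT (sub_pos.2 (hlt γ hγ ha))] with η h _ using h.2
    · exact Eventually.of_forall fun η h => absurd h ha
  obtain ⟨η, hη, hη0⟩ := (hsmall.and self_mem_nhdsWithin).exists
  refine ⟨η, hη0, fun t ht => ?_⟩
  set F := fibreOutside f R t with hFdef
  have hFiff : ∀ {s : ℝ → ℝ} {r : ℝ}, milnorRadius f < r →
      (pol r (s r) ∈ F ↔ R < r ∧ value f (pol r (s r)) = t) := by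
    intro s r hr
    rw [hFdef, fibreOutside, Set.mem_ofPred_eq, mem_closedBall_zero_iff,
      norm_pol (pos_of_milnorRadius_lt hr).le, not_le]
  have hexists : ∀ γ ∈ milnorArcs f, IncreasesTo f γ a →
      ∃ r > R, value f (pol r (σ γ r)) = t := by
    intro γ hγ ha
    have hlim := ((htail γ hγ _ (hσ γ hγ) (hσγ γ hγ)).1 ha).2
    have hlo : value f (pol R (σ γ R)) < t := by linarith [((hη γ hγ).2 ha), ht.1]
    obtain ⟨r₁, hr₁, hr₁t⟩ :=
      ((eventually_gt_atTop R).and ((tendsto_order.1 hlim).1 t ht.2)).exists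
    have hc : ContinuousOn (fun r => value f (pol r (σ γ r))) (Set.Icc R r₁) :=
      (continuous_value f).comp_continuousOn ((hσ γ hγ).continuousOn_pol.mono
        fun r hr => hRR.trans_le hr.1)
    obtain ⟨r, hr, hrt⟩ := intermediate_value_Ioo hr₁.le hc ⟨hlo, hr₁t⟩
    exact ⟨r, hr.1, hrt⟩
  choose! ρ hρ hρt using hexists
  have hmeet : ∀ γ ∈ milnorArcs f, IncreasesTo f γ a →
      γ ∩ F = {pol (ρ γ) (σ γ (ρ γ))} := by
    intro γ hγ ha
    have hmono := ((htail γ hγ _ (hσ γ hγ) (hσγ γ hγ)).1 ha).1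
    have hργ := hρ γ hγ ha
    ext x
    rw [Set.mem_singleton_iff]
    constructor
    · rintro ⟨hxγ, hxF⟩
      rw [hσγ γ hγ] at hxγ
      obtain ⟨r, hr, rfl⟩ := hxγ
      obtain ⟨hRr, hrt⟩ := (hFiff hr).1 hxF
      have : r = ρ γ := hmono.injOn ((hBR γ hγ).trans hRr) ((hBR γ hγ).trans hργ)
        (hrt.trans (hρt γ hγ ha).symm)
      rw [this]
    · rintro rfl
      have h0 : milnorRadius f < ρ γ := hRR.trans hργ
      refine ⟨?_, (hFiff h0).2 ⟨hργ, hρt γ hγ ha⟩⟩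
      exact (Set.ext_iff.1 (hσγ γ hγ) _).2 ⟨ρ γ, h0, rfl⟩
  refine ⟨?_, fun γ => pol (ρ γ) (σ γ (ρ γ)), hmeet, ?_⟩
  · rintro γ hγ ⟨x, hxγ, hxF⟩
    by_contra ha
    rw [hσγ γ hγ] at hxγ
    obtain ⟨r, hr, rfl⟩ := hxγ
    obtain ⟨hRr, hrt⟩ := (hFiff hr).1 hxF
    refine (htail γ hγ _ (hσ γ hγ) (hσγ γ hγ)).2 ha r ((hBR γ hγ).trans hRr) ?_
    rw [hrt]
    exact ⟨by linarith [(hη γ hγ).1, ht.1], ht.2⟩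
  · intro γ hγ δ hδ hγa hδa hcons
    obtain ⟨s, s', h, hγs, hδs⟩ := hcons.exists_isNext hf hγ hδ
    have hs := ((htail γ hγ s h.left hγs).1 hγa).1
    have hs' := ((htail δ hδ s' h.right hδs).1 hδa).1
    have h1 : milnorRadius f < ρ γ := hRR.trans (hρ γ hγ hγa)
    have h2 : milnorRadius f < ρ δ := hRR.trans (hρ δ hδ hδa)
    have e1 : pol (ρ γ) (σ γ (ρ γ)) = pol (ρ γ) (s (ρ γ)) :=
      pol_eq_of_arc_eq (hγs.symm.trans (hσγ γ hγ)) h1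
    have e2 : pol (ρ δ) (σ δ (ρ δ)) = pol (ρ δ) (s' (ρ δ)) :=
      pol_eq_of_arc_eq (hδs.symm.trans (hσγ δ hδ)) h2
    simp only [e1, e2]
    exact h.connectedComponentIn_eq (B := max (B γ) (B δ)) ((hB γ hγ).trans (le_max_left _ _))
      (max_lt (hBR γ hγ) (hBR δ hδ))
      (hs.mono (Set.Ioi_subset_Ioi (le_max_left _ _)))
      (hs'.mono (Set.Ioi_subset_Ioi (le_max_right _ _)))
      (hρ γ hγ hγa) (hρ δ hδ hδa) (e1 ▸ hρt γ hγ hγa) (e2 ▸ hρt δ hδ hδa)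

end MilnorCluster

end

open MilnorCluster

theorem mainTheorem2 (f : MilnorCluster.Poly) (hf : MilnorCluster.IsPrimitive f) (a : ℝ) :
    {C | MilnorCluster.IsIncreasingCluster f a C}.Finite ∧
    ∃ R₁ > MilnorCluster.milnorRadius f, 0 < R₁ ∧ ∀ R ≥ R₁, ∃ η > 0, ∀ t ∈ Set.Ioo (a - η) a,
      ∃ α : {C // MilnorCluster.IsIncreasingCluster f a C} →
          {F // F ∈ MilnorCluster.components (MilnorCluster.fibreOutside f R t)},
        (∀ C F, MilnorCluster.MeetsAllArcs F.1 C.1 ↔ F = α C) ∧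
        Function.Injective α := by
  refine ⟨finite_clusters hf a, ?_⟩
  obtain ⟨R₁, hR₁, hstruct⟩ := exists_fibre_structure hf a
  refine ⟨R₁, hR₁, pos_of_milnorRadius_lt hR₁, fun R hR => ?_⟩
  obtain ⟨η, hη, hstruct⟩ := hstruct R hR
  refine ⟨η, hη, fun t ht => ?_⟩
  obtain ⟨hinc, P, hP, hconn⟩ := hstruct t ht
  set F := fibreOutside f R t with hFdef
  have hmem : ∀ γ ∈ milnorArcs f, IncreasesTo f γ a → P γ ∈ γ ∩ F := fun γ hγ ha => by
    rw [hP γ hγ ha]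
    exact rfl
  have hPF : ∀ {C} (hC : IsIncreasingCluster f a C) {γ}, γ ∈ C → P γ ∈ γ ∩ F := fun hC γ hγ =>
    hmem γ (hC.arcs γ hγ) (hC.increases γ hγ)
  have hcomp : ∀ {C} (hC : IsIncreasingCluster f a C) {γ}, γ ∈ C →
      connectedComponentIn F (P γ) = connectedComponentIn F (P (C.head hC.ne_nil)) :=
    fun hC γ hγ => hC.eq_head_of_forall_isConsecutive (φ := fun γ => connectedComponentIn F (P γ))
      (fun γ hγ δ hδ => hconn γ (hC.arcs γ hγ) δ (hC.arcs δ hδ) (hC.increases γ hγ)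
        (hC.increases δ hδ)) hγ
  refine ⟨fun C => ⟨connectedComponentIn F (P (C.1.head C.2.ne_nil)),
    _, (hPF C.2 (List.head_mem _)).2, rfl⟩, ?_, ?_⟩
  · rintro ⟨C, hC⟩ ⟨K, hK⟩
    refine Iff.trans ?_ Subtype.ext_iff.symm
    show MeetsAllArcs K C ↔ K = connectedComponentIn F (P (C.head hC.ne_nil))
    obtain ⟨p, hp, rfl⟩ := hK
    constructor
    · intro hmeets
      obtain ⟨x, hxK, hxγ⟩ := hmeets _ (List.head_mem hC.ne_nil)
      have hx : x ∈ C.head hC.ne_nil ∩ F := ⟨hxγ, connectedComponentIn_subset F p hxK⟩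
      rw [hP _ hC.head_mem_milnorArcs (hC.increases _ (List.head_mem _))] at hx
      rw [← Set.mem_singleton_iff.1 hx]
      exact connectedComponentIn_eq hxK
    · intro heq γ hγ
      refine ⟨P γ, ?_, (hPF hC hγ).1⟩
      simp only [heq, ← hcomp hC hγ]
      exact mem_connectedComponentIn (hPF hC hγ).2
  · rintro ⟨C, hC⟩ ⟨C', hC'⟩ heq
    have heq : connectedComponentIn F (P (C.head hC.ne_nil)) =
        connectedComponentIn F (P (C'.head hC'.ne_nil)) := congrArg Subtype.val heq
    obtain ⟨T, hCT, hTC, hT⟩ := hC.exists_family hf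
    have harc : ∀ {u}, IsBranch f u → arc f u ∈ milnorArcs f := fun hu =>
      (mem_milnorArcs_iff hf).2 ⟨_, hu, rfl⟩
    have hFR : ∀ x ∈ F, milnorRadius f < ‖x‖ := fun x hx => by
      have := hx.1
      rw [mem_closedBall_zero_iff, not_le] at this
      exact (hR₁.le.trans hR).trans_lt this
    obtain ⟨s, hs, hsC⟩ := (mem_milnorArcs_iff hf).1 hC.head_mem_milnorArcs
    obtain ⟨u, hu, huC⟩ := (mem_milnorArcs_iff hf).1 hC'.head_mem_milnorArcs
    have hp := hPF hC (List.head_mem hC.ne_nil)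
    have hq := hPF hC' (List.head_mem hC'.ne_nil)
    have hTu := arc_mem_of_mem_connectedComponentIn hf hFR
      (fun v v' hv hne => hT v v' hv (hinc _ (harc hv.right) (Set.inter_comm _ _ ▸ hne)))
      hs hu ((Set.ext_iff.1 hsC _).1 hp.1) (hsC ▸ hCT _ (List.head_mem _))
      ((Set.ext_iff.1 huC _).1 hq.1) hp.2 (heq ▸ mem_connectedComponentIn hq.2)
    rw [← huC] at hTu
    have hmemC := hTC _ hTu (hC'.increases _ (List.head_mem _))
    exact Subtype.ext (hC.eq_of_head_eq hf hC' (hC.head_eq_of_mem hC' hmemC).symm)
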